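/- Let $K$ be an algebraically closed field of characteristic $0$, let $n\ge 0$ and $v\ge 1$ be integers, and let $Y\subset\mathbb P^{n+v}$ be an integral closed subvariety of dimension $m$ over $K$ that is not contained in a hyperplane. For a subset $X\subset\mathbb P^N$ and a point $P\in\mathbb P^N$, let the $X$-rank $R_X(P)$ be the least number of distinct points of $X$ whose linear span contains $P$; let the $s$-th secant variety $\sigma_s(X)$ be the Zariski closure of the set of points of $X$-rank at most $s$; let the generic rank $\alpha_X$ be the least $s$ with $\sigma_s(X)=\mathbb P^N$. For a $(v-1)$-dimensional linear subspace $V\subset\mathbb P^{n+v}$ with $V\cap Y=\emptyset$, let $X_V=\ell_V(Y)\subset\mathbb P^n$ be the image of $Y$ under the linear projection $\ell_V:\mathbb P^{n+v}\setminus V\to\mathbb P^n$ from $V$. (a) If $V$ contains a general point of $\mathbb P^{n+v}$, then $R_{X_V}(P)\le\alpha_Y$ for all $P\in\mathbb P^n$. That is, there is a non-empty Zariski open set $U\subset\mathbb P^{n+v}$ such that this holds for every $(v-1)$-dimensional linear subspace $V$ with $V\cap Y=\emptyset$ and $V\cap U\ne\emptyset$. (b) Let $b(Y,v)$ be the least $s$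 such that $\dim\sigma_s(Y)\ge n+1$. Then $$\left\lceil\frac{n+1}{m+1}\right\rceil\le b(Y,v)\le\alpha_Y-\left\lceil\frac{v-m-1}{m+1}\right\rceil ,$$ and for general $V$ one has $R_{X_V}(P)\le b(Y,v)$ for all $P\in\mathbb P^n$. That is, there is a non-empty Zariski open subset $G$ of the Grassmannian of $(v-1)$-dimensional linear subspaces of $\mathbb P^{n+v}$ such that this holds for every $V\in G$ with $V\cap Y=\emptyset$. -/

import Mathlib

open scoped LinearAlgebra.Projectivization

noncomputable section

namespace XRank

variable {K : Type*} [Field K]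

/-- The projective space `ℙ^N` over `K`: lines through the origin of `K^(N+1)`. -/
abbrev ProjSpace (K : Type*) [Field K] (N : ℕ) : Type _ := ℙ K (Fin (N + 1) → K)

/-- The Zariski topology on `ℙ^N`: the sets `{f ≠ 0}`, for `f` a homogeneous polynomial, are a
basis of open sets (whether `f` vanishes at a point does not depend on the representative). -/
instance zariski (N : ℕ) : TopologicalSpace (ProjSpace K N) :=
  TopologicalSpace.generateFrom
    {U | ∃ (d : ℕ) (f : MvPolynomial (Fin (N + 1)) K), f.IsHomogeneous d ∧
      U = {P | MvPolynomial.eval P.rep f ≠ 0}}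

/-- The Grassmannian of `r`-dimensional vector subspaces of `K^(N+1)`, that is of
`(r - 1)`-dimensional linear subspaces of `ℙ^N`. -/
def Grassmannian (K : Type*) [Field K] (r N : ℕ) : Type _ :=
  {V : Submodule K (Fin (N + 1) → K) // Module.finrank K V = r}

/-- The linear subspace of `ℙ^N` given by a point of the Grassmannian. -/
def Grassmannian.points {r N : ℕ} (V : Grassmannian K r N) : Set (ProjSpace K N) :=
  {P | P.submodule ≤ V.1}

/-- Linearly independent `r`-tuples of vectors of `K^(N+1)`. -/
def Frame (K : Type*) [Field K] (r N : ℕ) : Type _ :=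
  {B : Fin r → (Fin (N + 1) → K) // LinearIndependent K B}

/-- Frames carry the Zariski topology of the affine space of `r × (N+1)` matrices. -/
instance (r N : ℕ) : TopologicalSpace (Frame K r N) :=
  TopologicalSpace.generateFrom
    {U | ∃ f : MvPolynomial (Fin r × Fin (N + 1)) K,
      U = {B | MvPolynomial.eval (fun ij => B.1 ij.1 ij.2) f ≠ 0}}

/-- The subspace spanned by a frame. -/
def Frame.span {r N : ℕ} (B : Frame K r N) : Grassmannian K r N :=
  ⟨Submodule.span K (Set.range B.1), by simpa using finrank_span_eq_card B.2⟩

/-- The Zariski topology on the Grassmannian, as the quotient of the space of frames by the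
general linear group: a set of subspaces is open iff the frames spanning its members form a
Zariski open set. -/
instance (r N : ℕ) : TopologicalSpace (Grassmannian K r N) :=
  TopologicalSpace.coinduced Frame.span inferInstance

/-- The `X`-rank of `P`: the least number of distinct points of `X` whose linear span contains `P`
(it is `⊤` if there are no such points). -/
def xRank {N : ℕ} (X : Set (ProjSpace K N)) (P : ProjSpace K N) : ℕ∞ :=
  ⨅ (S : Finset (ProjSpace K N))
    (_ : (S : Set (ProjSpace K N)) ⊆ X ∧
      P ∈ Projectivization.Subspace.span (S : Set (ProjSpace K N))), (S.card : ℕ∞)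

/-- The `s`-th secant variety: the Zariski closure of the set of points of `X`-rank at most `s`. -/
def secantVariety {N : ℕ} (X : Set (ProjSpace K N)) (s : ℕ) : Set (ProjSpace K N) :=
  closure {P | xRank X P ≤ s}

/-- The generic `X`-rank: the least `s` such that the `s`-th secant variety is all of `ℙ^N`. -/
def genericRank {N : ℕ} (X : Set (ProjSpace K N)) : ℕ :=
  sInf {s | secantVariety X s = Set.univ}

/-- The least `s` such that the `s`-th secant variety of `Y ⊆ ℙ^(n+v)` has dimension at least
`n + 1`. -/
def bNumber (n v : ℕ) (Y : Set (ProjSpace K (n + v))) : ℕ :=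
  sInf {s | ((n + 1 : ℕ) : WithBot ℕ∞) ≤ topologicalKrullDim (secantVariety Y s)}

/-- `Y` is an integral (closed and irreducible) non-degenerate subvariety of `ℙ^N` of
dimension `m`. -/
structure IsNondegenerateVariety {N : ℕ} (Y : Set (ProjSpace K N)) (m : ℕ) : Prop where
  isClosed : IsClosed Y
  isIrreducible : IsIrreducible Y
  nondegenerate : Projectivization.Subspace.span Y = ⊤
  dim_eq : topologicalKrullDim Y = m

/-- A linear projection of `ℙ^(n+v)` onto `ℙ^n` with centre `V`, given by the surjective linear map
`K^(n+v+1) → K^(n+1)` with kernel `V` that induces it. -/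
structure LinearProjection {n v : ℕ} (V : Grassmannian K v (n + v)) where
  toLinearMap : (Fin (n + v + 1) → K) →ₗ[K] (Fin (n + 1) → K)
  surjective : Function.Surjective toLinearMap
  ker_eq : LinearMap.ker toLinearMap = V.1

namespace LinearProjection

variable {n v : ℕ} {V : Grassmannian K v (n + v)}

lemma map_rep_ne_zero (l : LinearProjection V) {P : ProjSpace K (n + v)} (hP : P ∉ V.points) :
    l.toLinearMap P.rep ≠ 0 := by
  intro h
  apply hP
  have h' : P.rep ∈ V.1 := by rw [← l.ker_eq]; exact h
  change P.submodule ≤ V.1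
  rw [Projectivization.submodule_eq, Submodule.span_singleton_le_iff_mem]
  exact h'

/-- The projection as a map `ℙ^(n+v) ∖ V → ℙ^n`. -/
def toFun (l : LinearProjection V) (P : {P : ProjSpace K (n + v) // P ∉ V.points}) :
    ProjSpace K n :=
  Projectivization.mk K (l.toLinearMap P.1.rep) (l.map_rep_ne_zero P.2)

/-- The image of (the part outside the centre of) `Y` under the projection. -/
def image (l : LinearProjection V) (Y : Set (ProjSpace K (n + v))) : Set (ProjSpace K n) :=
  l.toFun '' {P | P.1 ∈ Y}

end LinearProjection

end XRank

end

open scoped LinearAlgebra.Projectivization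

noncomputable section

namespace XRank

open MvPolynomial Cardinal

universe u

/-! ### Transcendence degree and Krull dimension -/

section Algebra

variable {K : Type u} [Field K]

/-! Everything is moved to the affine cone `C = cone Y` in `K^(n+v+1)`. Having rank at most `s`
means being a sum of `s` vectors of `C` (`xRank_le_iff`), so the dimension of a secant variety is
read off from `W = sumSet C s`.

Suppose `k + dim W` is at least `n + v + 1`. For general `B_1, …, B_k` the set `W + ⟨B_1, …, B_k⟩`
is dense (`vanishingIdeal_joinSet`), so by Chevalley (`IsParametrized.exists_forall_mem`) there is a
non-zero polynomial `F` in `k + 1` vectors such that `F(B) ≠ 0` forces `B_{k+1} ∈ W + ⟨B_1, …,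
B_k⟩`. Let `V` contain one tuple with `F(B) ≠ 0`, and let `x` be a lift of an arbitrary `P`. Then
`F` is still non-zero after replacing `B_{k+1}` by `B_{k+1} + t x` for some `t ≠ 0`. Projecting the
resulting decomposition from `V` kills every `B_j` and writes `t P` as a sum of `s` vectors of the
projected cone (`xRank_image_le`). The extra vector `B_{k+1}` of `V` is what turns "for general `P`"
into "for every `P`".

Part (a) is `k = 0` with `s` the generic rank, where `W` itself is dense. Part (b) is `k = v - 1`
with `s = b(Y, v)`, where `dim W ≥ n + 2`. The numerical bounds hold because `t` further summands
raise the dimension of a sum set by at most `t (m + 1)`.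

Dimensions of affine sets are transcendence degrees of coordinate rings;
`le_affDim_cone_of_le_topologicalKrullDim` and `le_topologicalKrullDim_of_le_affDim_cone` compare
them with topological Krull dimensions in projective space. -/

lemma trdeg_le_add_of_adjoin_eq_top {A B R : Type u} [CommRing A] [CommRing B] [CommRing R]
    [Algebra K A] [Algebra K B] [Algebra K R] [IsDomain R] (f : A →ₐ[K] R) (g : B →ₐ[K] R)
    (hf : Function.Injective f) (hg : Function.Injective g)
    (h : f.range ⊔ g.range = ⊤) :
    Algebra.trdeg K R ≤ Algebra.trdeg K A + Algebra.trdeg K B := by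
  have : IsDomain A := hf.isDomain f.toRingHom
  have : IsDomain B := hg.isDomain g.toRingHom
  obtain ⟨s, hs⟩ := exists_isTranscendenceBasis K A
  obtain ⟨t, ht⟩ := exists_isTranscendenceBasis K B
  set U : Set R := f '' s ∪ g '' t
  have key : ∀ {A : Type u} [CommRing A] [Algebra K A] (f : A →ₐ[K] R)
      (_ : Function.Injective f) (s : Set A) (_ : IsTranscendenceBasis K ((↑) : s → A))
      (_ : f '' s ⊆ U) (a : A), IsAlgebraic (Algebra.adjoin K U) (f a) := by
    intro A _ _ f hf s hs hsU a
    have halg := hs.isAlgebraic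
    rw [Subtype.range_coe] at halg
    have hle : (Algebra.adjoin K s).map f ≤ Algebra.adjoin K U := by
      rw [AlgHom.map_adjoin]
      exact Algebra.adjoin_mono hsU
    let φ : Algebra.adjoin K s →ₐ[K] Algebra.adjoin K U :=
      (f.comp (Algebra.adjoin K s).val).codRestrict _
        fun x => hle ⟨x, x.2, rfl⟩
    refine (halg.isAlgebraic a).ringHom_of_comp_eq φ.toRingHom f.toRingHom ?_ ?_
    · intro x y hxy
      exact Subtype.ext (hf (congrArg Subtype.val hxy))
    · rfl
  have halg : Algebra.IsAlgebraic (Algebra.adjoin K U) R := by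
    refine ⟨fun x => ?_⟩
    -- The elements algebraic over `K[U]` form a subalgebra, so it suffices that it contains both
    -- generating images.
    let S : Subalgebra K R :=
      (Subalgebra.algebraicClosure (Algebra.adjoin K U) R).restrictScalars K
    have hS : (⊤ : Subalgebra K R) ≤ S := by
      rw [← h]
      refine sup_le ?_ ?_
      · rintro _ ⟨a, rfl⟩
        exact key f hf s hs Set.subset_union_left a
      · rintro _ ⟨a, rfl⟩
        exact key g hg t ht Set.subset_union_right a
    exact hS (Algebra.mem_top (x := x))
  calc Algebra.trdeg K R ≤ #U := Algebra.IsAlgebraic.trdeg_le_cardinalMk K U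
    _ ≤ #(f '' s) + #(g '' t) := mk_union_le _ _
    _ ≤ #s + #t := add_le_add mk_image_le mk_image_le
    _ = _ := by rw [hs.cardinalMk_eq_trdeg, ht.cardinalMk_eq_trdeg]

/-- The induced map of quotients is injective. Geometrically, the image of a polynomial map has
dimension at most that of its source. -/
lemma trdeg_quotient_le_of_comap_eq {A B : Type u} [CommRing A] [CommRing B]
    [Algebra K A] [Algebra K B] (φ : A →ₐ[K] B) (I : Ideal A) (J : Ideal B)
    (h : I = J.comap φ) : Algebra.trdeg K (A ⧸ I) ≤ Algebra.trdeg K (B ⧸ J) := by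
  refine _root_.trdeg_le_of_injective (Ideal.quotientMapₐ J φ h.le) ?_
  exact Ideal.quotientMap_injective' (H := h.le) h.ge

/-- The Krull dimension of a finitely generated domain is at least its transcendence degree. -/
lemma trdeg_le_ringKrullDim {R : Type u} [CommRing R] [IsDomain R] [Algebra K R]
    [Algebra.FiniteType K R] {d : ℕ} (hd : (d : Cardinal.{u}) ≤ Algebra.trdeg K R) :
    (d : WithBot ℕ∞) ≤ ringKrullDim R := by
  -- Noether normalization: `R` is integral over a polynomial ring in `s = trdeg R` variables. A
  -- chain of primes there lifts to `R`, its head by lying over and the rest by going up.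
  obtain ⟨s, g, hinj, hint⟩ := exists_integral_inj_algHom_of_fg K R
  algebraize [g.toRingHom]
  have hst : IsScalarTower K (MvPolynomial (Fin s) K) R :=
    IsScalarTower.of_algebraMap_eq fun x => (g.commutes x).symm
  have hfaith : FaithfulSMul (MvPolynomial (Fin s) K) R :=
    (faithfulSMul_iff_algebraMap_injective _ _).mpr hinj
  have htr : Algebra.trdeg K R = s := by
    rw [← _root_.trdeg_add_eq K (MvPolynomial (Fin s) K) (A := R),
      trdeg_eq_zero (R := MvPolynomial (Fin s) K), MvPolynomial.trdeg_of_isDomain]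
    simp
  rw [htr, Nat.cast_le] at hd
  have hdim : ((s : ℕ) : WithBot ℕ∞) ≤ ringKrullDim (MvPolynomial (Fin s) K) := by
    rw [MvPolynomial.ringKrullDim_of_isNoetherianRing]
    simp
  have hdim' : ((d : ℕ) : WithBot ℕ∞) ≤ ringKrullDim (MvPolynomial (Fin s) K) :=
    le_trans (by exact_mod_cast hd) hdim
  obtain ⟨l, hl⟩ := Order.le_krullDim_iff.mp hdim'
  obtain ⟨P, hP⟩ := Algebra.IsIntegral.comap_surjective (MvPolynomial (Fin s) K) R
    (RelSeries.head l)
  have hlo : P.asIdeal.LiesOver (RelSeries.head l).asIdeal := ⟨by rw [← hP]; rfl⟩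
  obtain ⟨L, hL, -⟩ := Ideal.exists_ltSeries_of_hasGoingUp l P.asIdeal
  exact Order.le_krullDim_iff.mpr ⟨L, hL.trans hl⟩

/-- The transcendence degree drops strictly modulo a non-zero prime ideal. -/
lemma trdeg_quotient_add_one_le {A : Type u} [CommRing A] [Algebra K A] {p q : Ideal A}
    [p.IsPrime] [q.IsPrime] (hpq : p < q) :
    Algebra.trdeg K (A ⧸ q) + 1 ≤ Algebra.trdeg K (A ⧸ p) := by
  obtain ⟨f, hfq, hfp⟩ := SetLike.exists_of_lt hpq
  obtain ⟨s, hs⟩ := exists_isTranscendenceBasis K (A ⧸ q)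
  let π : A ⧸ p →ₐ[K] A ⧸ q := Ideal.Quotient.factorₐ K hpq.le
  have hπ : Function.Surjective π := Ideal.Quotient.factor_surjective hpq.le
  choose r hr using hπ
  let y : s → A ⧸ p := fun i => r i
  have hπy : π ∘ y = ((↑) : s → A ⧸ q) := by
    ext i
    exact hr i
  have hy : AlgebraicIndependent K y := .of_comp π (by rw [hπy]; exact hs.1)
  -- A lifted transcendence basis of `A ⧸ q` gains the class of `f` as one more independent element.
  -- Otherwise that class divides a non-zero polynomial in the basis, which then dies in `A ⧸ q`,
  -- against independence.
  have hz : AlgebraicIndependent K (fun o : Option s => o.elim (Ideal.Quotient.mk p f) y) := by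
    rw [hy.option_iff_transcendental]
    intro halg
    have hne : Ideal.Quotient.mk p f ≠ 0 := by rwa [Ne, Ideal.Quotient.eq_zero_iff_mem]
    obtain ⟨⟨a, ha⟩, ha0, w, haw⟩ :=
      halg.exists_nonzero_dvd (mem_nonZeroDivisors_of_ne_zero hne)
    rw [Algebra.adjoin_range_eq_range_aeval] at ha
    obtain ⟨P, rfl⟩ := ha
    change aeval y P = _ at haw
    have h0 : aeval ((↑) : s → A ⧸ q) P = 0 := by
      have hfq' : π (Ideal.Quotient.mk p f) = 0 := Ideal.Quotient.eq_zero_iff_mem.mpr hfq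
      have : aeval (π ∘ y) P = 0 := by
        have hc : aeval (π ∘ y) P = π (aeval y P) := (comp_aeval_apply y π P).symm
        rw [hc, haw, map_mul, hfq', zero_mul]
      rwa [hπy] at this
    refine ha0 (Subtype.ext ?_)
    change aeval y P = 0
    rw [hs.1.eq_zero_of_aeval_eq_zero P h0, map_zero]
  have := hz.cardinalMk_le_trdeg
  rw [mk_option, hs.cardinalMk_eq_trdeg] at this
  exact this

end Algebra

/-! ### Irreducible affine sets -/

section Affine

variable {K : Type u} [Field K] {σ τ : Type}

lemma mem_vanishingIdeal {W : Set (σ → K)} {f : MvPolynomial σ K} :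
    f ∈ vanishingIdeal K W ↔ ∀ x ∈ W, eval x f = 0 := by
  simp [mem_vanishingIdeal_iff, aeval_eq_eval]

lemma mem_zeroLocus {I : Ideal (MvPolynomial σ K)} {x : σ → K} :
    x ∈ zeroLocus K I ↔ ∀ f ∈ I, eval x f = 0 := by
  simp [mem_zeroLocus_iff, aeval_eq_eval]

/-- The dimension of (the Zariski closure of) an irreducible subset of affine space. -/
def affDim (W : Set (σ → K)) : Cardinal.{u} :=
  Algebra.trdeg K (MvPolynomial σ K ⧸ vanishingIdeal K W)

/-- The polynomial map given by a family of polynomials. -/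
def polyMap (g : τ → MvPolynomial σ K) (x : σ → K) : τ → K := fun i => eval x (g i)

/-- The product of two subsets of affine spaces. -/
def affProd {K : Type u} (A : Set (σ → K)) (B : Set (τ → K)) : Set (σ ⊕ τ → K) :=
  {x | x ∘ Sum.inl ∈ A ∧ x ∘ Sum.inr ∈ B}

lemma sumElim_mem_affProd {K : Type u} {A : Set (σ → K)} {B : Set (τ → K)} {a : σ → K} {b : τ → K}
    (ha : a ∈ A) (hb : b ∈ B) : Sum.elim a b ∈ affProd A B := ⟨ha, hb⟩

lemma eval_polyMap (g : τ → MvPolynomial σ K) (x : σ → K) (f : MvPolynomial τ K) :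
    eval (polyMap g x) f = eval x (bind₁ g f) := by
  have h := aeval_bind₁ (f := x) (g := g) f
  simp only [aeval_eq_eval] at h
  exact h.symm

lemma vanishingIdeal_polyMap_image (g : τ → MvPolynomial σ K) (W : Set (σ → K)) :
    vanishingIdeal K (polyMap g '' W) = (vanishingIdeal K W).comap (bind₁ g) := by
  ext f
  simp only [Ideal.mem_comap, mem_vanishingIdeal, Set.forall_mem_image, eval_polyMap]

lemma isPrime_vanishingIdeal_polyMap_image (g : τ → MvPolynomial σ K) {W : Set (σ → K)}
    (hW : (vanishingIdeal K W).IsPrime) : (vanishingIdeal K (polyMap g '' W)).IsPrime := by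
  rw [vanishingIdeal_polyMap_image]
  exact Ideal.comap_isPrime _ _

lemma affDim_polyMap_image_le (g : τ → MvPolynomial σ K) (W : Set (σ → K)) :
    affDim (polyMap g '' W) ≤ affDim W :=
  trdeg_quotient_le_of_comap_eq (bind₁ g) _ _ (vanishingIdeal_polyMap_image g W)

lemma affDim_mono {V W : Set (σ → K)} (h : V ⊆ W) : affDim V ≤ affDim W :=
  trdeg_le_of_surjective (Ideal.Quotient.factorₐ K (vanishingIdeal_anti_mono h))
    (Ideal.Quotient.factor_surjective (vanishingIdeal_anti_mono h))

lemma nonempty_of_isPrime_vanishingIdeal {W : Set (σ → K)} (hW : (vanishingIdeal K W).IsPrime) :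
    W.Nonempty := by
  by_contra h
  rw [Set.not_nonempty_iff_eq_empty] at h
  exact hW.ne_top (by rw [h, vanishingIdeal_empty])

lemma eval_partial_left (f : MvPolynomial (σ ⊕ τ) K) (a : σ → K) (b : τ → K) :
    eval b (bind₁ (Sum.elim (fun i => C (a i)) X) f) = eval (Sum.elim a b) f := by
  rw [← eval_polyMap]
  congr 2
  ext (i | i) <;> simp [polyMap]

lemma eval_partial_right (f : MvPolynomial (σ ⊕ τ) K) (a : σ → K) (b : τ → K) :
    eval a (bind₁ (Sum.elim X (fun i => C (b i))) f) = eval (Sum.elim a b) f := by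
  rw [← eval_polyMap]
  congr 2
  ext (i | i) <;> simp [polyMap]

/-- If `f` and `g` are non-zero at `x` and `y`, freeze the second coordinates there: irreducibility
of `A` gives one `a` with `f(a, ·)` and `g(a, ·)` both non-zero somewhere on `B`. Irreducibility of
`B` then concludes. -/
lemma isPrime_vanishingIdeal_affProd {A : Set (σ → K)} {B : Set (τ → K)}
    (hA : (vanishingIdeal K A).IsPrime) (hB : (vanishingIdeal K B).IsPrime) :
    (vanishingIdeal K (affProd A B)).IsPrime := by
  obtain ⟨a₀, ha₀⟩ := nonempty_of_isPrime_vanishingIdeal hA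
  obtain ⟨b₀, hb₀⟩ := nonempty_of_isPrime_vanishingIdeal hB
  refine ⟨fun h => ?_, fun {f g} hfg => ?_⟩
  · have h1 : (1 : MvPolynomial (σ ⊕ τ) K) ∈ vanishingIdeal K (affProd A B) := by
      rw [h]; trivial
    simpa using mem_vanishingIdeal.mp h1 _ (sumElim_mem_affProd ha₀ hb₀)
  · by_contra! hcon
    simp only [mem_vanishingIdeal, not_forall] at hcon
    obtain ⟨⟨x, hx, hfx⟩, y, hy, hgy⟩ := hcon
    set f' := bind₁ (Sum.elim X (fun i => C ((x ∘ Sum.inr) i))) f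
    set g' := bind₁ (Sum.elim X (fun i => C ((y ∘ Sum.inr) i))) g
    have hf' : f' ∉ vanishingIdeal K A := fun h => hfx <| by
      have := mem_vanishingIdeal.mp h _ hx.1
      rwa [eval_partial_right, Sum.elim_comp_inl_inr] at this
    have hg' : g' ∉ vanishingIdeal K A := fun h => hgy <| by
      have := mem_vanishingIdeal.mp h _ hy.1
      rwa [eval_partial_right, Sum.elim_comp_inl_inr] at this
    have hfg' : f' * g' ∉ vanishingIdeal K A := fun h => (hA.mem_or_mem h).elim hf' hg'
    simp only [mem_vanishingIdeal, not_forall, map_mul] at hfg'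
    obtain ⟨a, ha, hne⟩ := hfg'
    set f'' := bind₁ (Sum.elim (fun i => C (a i)) X) f
    set g'' := bind₁ (Sum.elim (fun i => C (a i)) X) g
    have hmem : f'' * g'' ∈ vanishingIdeal K B := mem_vanishingIdeal.mpr fun b hb => by
      rw [map_mul, eval_partial_left, eval_partial_left, ← map_mul]
      exact mem_vanishingIdeal.mp hfg _ (sumElim_mem_affProd ha hb)
    rw [eval_partial_right, eval_partial_right] at hne
    rcases hB.mem_or_mem hmem with h | h
    · refine hne ?_
      rw [← eval_partial_left, mem_vanishingIdeal.mp h _ hx.2, zero_mul]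
    · refine hne ?_
      rw [← eval_partial_left g, mem_vanishingIdeal.mp h _ hy.2, mul_zero]

/-- The coordinate rings of the factors embed in that of the product, because the other factor is
non-empty, and together they generate it. -/
lemma affDim_affProd_le {A : Set (σ → K)} {B : Set (τ → K)}
    (hA : (vanishingIdeal K A).IsPrime) (hB : (vanishingIdeal K B).IsPrime) :
    affDim (affProd A B) ≤ affDim A + affDim B := by
  obtain ⟨a₀, ha₀⟩ := nonempty_of_isPrime_vanishingIdeal hA
  obtain ⟨b₀, hb₀⟩ := nonempty_of_isPrime_vanishingIdeal hB
  have hP := isPrime_vanishingIdeal_affProd hA hB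
  have h1 : vanishingIdeal K A =
      (vanishingIdeal K (affProd A B)).comap (rename (R := K) (Sum.inl : σ → σ ⊕ τ)) := by
    ext f
    simp only [Ideal.mem_comap, mem_vanishingIdeal, eval_rename]
    exact ⟨fun h x hx => h _ hx.1, fun h x hx => h (Sum.elim x b₀) (sumElim_mem_affProd hx hb₀)⟩
  have h2 : vanishingIdeal K B =
      (vanishingIdeal K (affProd A B)).comap (rename (R := K) (Sum.inr : τ → σ ⊕ τ)) := by
    ext f
    simp only [Ideal.mem_comap, mem_vanishingIdeal, eval_rename]
    exact ⟨fun h x hx => h _ hx.2, fun h x hx => h (Sum.elim a₀ x) (sumElim_mem_affProd ha₀ hx)⟩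
  refine trdeg_le_add_of_adjoin_eq_top
    (Ideal.quotientMapₐ _ _ h1.le) (Ideal.quotientMapₐ _ _ h2.le)
    (Ideal.quotientMap_injective' (H := h1.le) h1.ge)
    (Ideal.quotientMap_injective' (H := h2.le) h2.ge) ?_
  rw [eq_top_iff]
  rintro x -
  obtain ⟨f, rfl⟩ := Ideal.Quotient.mk_surjective x
  induction f using MvPolynomial.induction_on with
  | C c => exact Subalgebra.algebraMap_mem _ c
  | add p q hp hq => rw [map_add]; exact add_mem hp hq
  | mul_X p i hp =>
    rw [map_mul]
    refine mul_mem hp ?_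
    rcases i with i | i
    · refine Algebra.mem_sup_left ⟨Ideal.Quotient.mk _ (X i), ?_⟩
      simp
    · refine Algebra.mem_sup_right ⟨Ideal.Quotient.mk _ (X i), ?_⟩
      simp

lemma vanishingIdeal_univ [Infinite K] : vanishingIdeal K (Set.univ : Set (σ → K)) = ⊥ := by
  rw [eq_bot_iff]
  intro f hf
  rw [mem_vanishingIdeal] at hf
  exact MvPolynomial.funext fun x => by simpa using hf x trivial

lemma affDim_eq_card_of_vanishingIdeal_eq_bot [Fintype σ] {W : Set (σ → K)}
    (hW : vanishingIdeal K W = ⊥) : affDim W = Fintype.card σ := by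
  rw [affDim, hW, (AlgEquiv.quotientBot K (MvPolynomial σ K)).trdeg_eq,
    MvPolynomial.trdeg_of_isDomain]
  simp

lemma affDim_singleton_zero [Infinite K] : affDim ({0} : Set (σ → K)) = 0 := by
  have h : ({0} : Set (σ → K)) ⊆
      polyMap (fun _ : σ => (0 : MvPolynomial Empty K)) '' Set.univ := by
    rintro _ rfl
    exact ⟨fun _ => 0, trivial, by funext j; simp [polyMap]⟩
  have h1 := (affDim_mono h).trans (affDim_polyMap_image_le _ _)
  rw [affDim_eq_card_of_vanishingIdeal_eq_bot vanishingIdeal_univ] at h1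
  simpa using h1

lemma affDim_lt_aleph0 [Finite σ] (W : Set (σ → K)) : affDim W < ℵ₀ := by
  have := trdeg_lt_aleph0_of_finiteType (R := K) (S := MvPolynomial σ K ⧸ vanishingIdeal K W)
  exact this

/-- An irreducible set of dimension at least `k` projects dominantly to some `k` of the
coordinates. -/
lemma exists_coordinates_of_le_affDim [Infinite K] [Fintype σ] [DecidableEq σ] {W : Set (σ → K)}
    (hW : (vanishingIdeal K W).IsPrime) {k : ℕ} (hk : (k : Cardinal.{u}) ≤ affDim W) :
    ∃ J : Finset σ, J.card = k ∧ ∀ h : MvPolynomial σ K,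
      (∀ w ∈ W, ∀ x : σ → K, (∀ j ∈ J, x j = w j) → eval x h = 0) → h = 0 := by
  let R := MvPolynomial σ K ⧸ vanishingIdeal K W
  let ξ : σ → R := fun i => Ideal.Quotient.mk _ (X i)
  have hξ : Algebra.adjoin K (Set.range ξ) = ⊤ := by
    have : Set.range ξ = (Ideal.Quotient.mkₐ K (vanishingIdeal K W)) '' Set.range X := by
      rw [← Set.range_comp]; rfl
    rw [this, ← AlgHom.map_adjoin, adjoin_range_X, Algebra.map_top, AlgHom.range_eq_top]
    exact Ideal.Quotient.mkₐ_surjective _ _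
  have halg : Algebra.IsAlgebraic (Algebra.adjoin K (Set.range ξ)) R := by
    rw [hξ]
    exact ⟨fun x => isAlgebraic_algebraMap (⟨x, Algebra.mem_top⟩ : (⊤ : Subalgebra K R))⟩
  -- The coordinate functions generate the ring, so a transcendence basis can be chosen among them;
  -- `J` indexes `k` of its members.
  obtain ⟨t, htξ, ht⟩ := exists_isTranscendenceBasis_subset (R := K) (Set.range ξ)
  choose r hr using fun a : t => htξ a.2
  have hrinj : Function.Injective r := fun a b hab => Subtype.ext (by rw [← hr, ← hr, hab])
  have htfin : Finite t := Finite.of_injective r hrinj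
  have := Fintype.ofFinite t
  have hcard : k ≤ (Finset.univ.image r).card := by
    rw [Finset.card_image_of_injective _ hrinj, Finset.card_univ]
    rw [affDim, ← ht.cardinalMk_eq_trdeg, mk_fintype] at hk
    exact_mod_cast hk
  obtain ⟨J, hJ, hJk⟩ := Finset.exists_subset_card_eq hcard
  refine ⟨J, hJk, fun h hh => ?_⟩
  have hind : AlgebraicIndependent K (fun j : J => ξ j) := by
    have hmem : ∀ j : J, ∃ a, r a = j := fun j => by simpa using hJ j.2
    choose a ha using hmem
    have hainj : Function.Injective a := fun i j hij => Subtype.ext (by rw [← ha, ← ha, hij])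
    have := ht.1.comp a hainj
    convert this using 1
    funext j
    simp [← ha, hr]
  refine MvPolynomial.funext fun x₀ => ?_
  rw [map_zero]
  -- With the coordinates outside `J` frozen at `x₀`, `h` becomes a polynomial relation between the
  -- independent coordinates of `W`, hence zero.
  let F : MvPolynomial J K :=
    bind₁ (fun i => if hi : i ∈ J then X ⟨i, hi⟩ else C (x₀ i)) h
  have hF : ∀ z : J → K, eval z F = eval (fun i => if hi : i ∈ J then z ⟨i, hi⟩ else x₀ i) h := by
    intro z
    rw [← eval_polyMap]
    congr 2
    ext i
    simp only [polyMap]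
    split_ifs <;> simp
  have hF0 : aeval (fun j : J => ξ j) F = 0 := by
    have : aeval (fun j : J => ξ j) F =
        Ideal.Quotient.mkₐ K (vanishingIdeal K W) (rename (Subtype.val : J → σ) F) := by
      have h2 := comp_aeval_apply (fun j : J => (X j.1 : MvPolynomial σ K))
        (Ideal.Quotient.mkₐ K (vanishingIdeal K W)) F
      rw [rename_eq_aeval]
      exact h2.symm
    rw [this]
    refine Ideal.Quotient.eq_zero_iff_mem.mpr (mem_vanishingIdeal.mpr fun w hw => ?_)
    rw [eval_rename, hF]
    exact hh w hw _ fun j hj => by simp [hj]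
  have := hF fun j => x₀ j
  rw [hind.eq_zero_of_aeval_eq_zero F hF0, map_zero] at this
  rw [this]
  congr 2
  ext i
  split_ifs <;> rfl

end Affine

/-! ### Images of irreducible closed sets -/

section Param

variable {K : Type u} [Field K] {σ τ : Type}

/-- A subset of affine space is parametrized if it is the image of an irreducible Zariski closed
set under a polynomial map. -/
def IsParametrized (W : Set (σ → K)) : Prop :=
  ∃ (ι : Type) (_ : Finite ι) (Z : Set (ι → K)) (g : σ → MvPolynomial ι K),
    zeroLocus K (vanishingIdeal K Z) ⊆ Z ∧ (vanishingIdeal K Z).IsPrime ∧ polyMap g '' Z = W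

lemma IsParametrized.isPrime {W : Set (σ → K)} (hW : IsParametrized W) :
    (vanishingIdeal K W).IsPrime := by
  obtain ⟨ι, _, Z, g, -, hZ, rfl⟩ := hW
  exact isPrime_vanishingIdeal_polyMap_image g hZ

lemma IsParametrized.of_isClosed [Finite σ] {W : Set (σ → K)}
    (hc : zeroLocus K (vanishingIdeal K W) ⊆ W) (hp : (vanishingIdeal K W).IsPrime) :
    IsParametrized W := by
  refine ⟨σ, ‹_›, W, X, hc, hp, ?_⟩
  have : polyMap (X : σ → MvPolynomial σ K) = id := by
    funext x i
    simp [polyMap]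
  rw [this, Set.image_id]

lemma isParametrized_univ [Finite σ] [Infinite K] :
    IsParametrized (Set.univ : Set (σ → K)) := by
  refine .of_isClosed (Set.subset_univ _) ?_
  rw [vanishingIdeal_univ]
  exact Ideal.isPrime_bot

lemma IsParametrized.image {W : Set (σ → K)} (hW : IsParametrized W)
    (g : τ → MvPolynomial σ K) : IsParametrized (polyMap g '' W) := by
  obtain ⟨ι, hι, Z, h, hc, hp, rfl⟩ := hW
  refine ⟨ι, hι, Z, fun i => bind₁ h (g i), hc, hp, ?_⟩
  rw [Set.image_image]
  refine Set.image_congr fun x _ => ?_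
  funext i
  exact (eval_polyMap h x (g i)).symm

lemma IsParametrized.prod {A : Set (σ → K)} {B : Set (τ → K)} (hA : IsParametrized A)
    (hB : IsParametrized B) : IsParametrized (affProd A B) := by
  obtain ⟨ι, hι, Z, g, hc, hp, rfl⟩ := hA
  obtain ⟨κ, hκ, Y, h, hc', hp', rfl⟩ := hB
  refine ⟨ι ⊕ κ, inferInstance, affProd Z Y,
    Sum.elim (fun i => rename Sum.inl (g i)) (fun i => rename Sum.inr (h i)), ?_,
    isPrime_vanishingIdeal_affProd hp hp', ?_⟩
  · intro x hx
    rw [mem_zeroLocus] at hx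
    refine ⟨hc (mem_zeroLocus.mpr fun f hf => ?_), hc' (mem_zeroLocus.mpr fun f hf => ?_)⟩
    · rw [← eval_rename]
      refine hx _ (mem_vanishingIdeal.mpr fun y hy => ?_)
      rw [eval_rename]
      exact mem_vanishingIdeal.mp hf _ hy.1
    · rw [← eval_rename]
      refine hx _ (mem_vanishingIdeal.mpr fun y hy => ?_)
      rw [eval_rename]
      exact mem_vanishingIdeal.mp hf _ hy.2
  · ext x
    constructor
    · rintro ⟨z, hz, rfl⟩
      refine ⟨⟨_, hz.1, ?_⟩, ⟨_, hz.2, ?_⟩⟩ <;>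
      · funext i
        simp [polyMap, eval_rename]
    · rintro ⟨⟨z, hz, hzx⟩, ⟨y, hy, hyx⟩⟩
      refine ⟨Sum.elim z y, sumElim_mem_affProd hz hy, ?_⟩
      funext i
      rcases i with i | i
      · simpa [polyMap, eval_rename] using congrFun hzx i
      · simpa [polyMap, eval_rename] using congrFun hyx i

/-- **Chevalley's theorem** for dominant maps: a dense parametrized set contains a non-empty
principal open set. -/
lemma IsParametrized.exists_forall_mem [IsAlgClosed K] [Finite σ] {W : Set (σ → K)}
    (hW : IsParametrized W) (hdense : vanishingIdeal K W = ⊥) :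
    ∃ F : MvPolynomial σ K, F ≠ 0 ∧ ∀ y : σ → K, eval y F ≠ 0 → y ∈ W := by
  obtain ⟨ι, _, Z, g, hc, hp, rfl⟩ := hW
  set I := vanishingIdeal K Z
  rw [vanishingIdeal_polyMap_image] at hdense
  let φ : MvPolynomial σ K →ₐ[K] MvPolynomial ι K ⧸ I := (Ideal.Quotient.mkₐ K I).comp (bind₁ g)
  have hφ : Function.Injective φ := by
    rw [injective_iff_map_eq_zero]
    intro f hf
    have : bind₁ g f ∈ I := Ideal.Quotient.eq_zero_iff_mem.mp hf
    rw [← Ideal.mem_comap] at this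
    rwa [hdense] at this
  have hfp : φ.toRingHom.FinitePresentation := by
    rw [← RingHom.FinitePresentation.of_finiteType]
    have h1 : (φ.toRingHom.comp (algebraMap K _)).FiniteType := by
      have : φ.toRingHom.comp (algebraMap K _) = algebraMap K (MvPolynomial ι K ⧸ I) :=
        RingHom.ext fun x => φ.commutes x
      rw [this, RingHom.finiteType_algebraMap]
      infer_instance
    exact h1.of_comp_finiteType
  -- The image of the spectrum is constructible and contains the generic point, as `φ` is injective.
  -- The piece containing that point has all its equations zero, so it is the basic open set of
  -- `D.f`.
  obtain ⟨S, hS⟩ := PrimeSpectrum.exists_constructibleSetData_iff.mpr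
    (PrimeSpectrum.isConstructible_range_comap hfp)
  have hbot : (⟨⊥, Ideal.isPrime_bot⟩ : PrimeSpectrum (MvPolynomial σ K)) ∈
      Set.range (PrimeSpectrum.comap φ.toRingHom) := by
    refine ⟨⟨⊥, Ideal.isPrime_bot⟩, PrimeSpectrum.ext ?_⟩
    exact Ideal.comap_bot_of_injective φ.toRingHom hφ
  rw [← hS, PrimeSpectrum.ConstructibleSetData.toSet, Set.mem_iUnion₂] at hbot
  obtain ⟨D, hD, hg, hf⟩ := hbot
  have hg0 : ∀ i, D.g i = 0 := fun i => hg ⟨i, rfl⟩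
  have hf0 : D.f ≠ 0 := fun h => hf (by rintro _ rfl; exact h)
  refine ⟨D.f, hf0, fun y hy => ?_⟩
  let 𝔪 : Ideal (MvPolynomial σ K) := vanishingIdeal K {y}
  have h𝔪 : 𝔪.IsMaximal := inferInstance
  have hmem : (⟨𝔪, h𝔪.isPrime⟩ : PrimeSpectrum (MvPolynomial σ K)) ∈
      Set.range (PrimeSpectrum.comap φ.toRingHom) := by
    rw [← hS, PrimeSpectrum.ConstructibleSetData.toSet, Set.mem_iUnion₂]
    refine ⟨D, hD, ?_, fun h => hy ?_⟩
    · rintro _ ⟨i, rfl⟩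
      rw [hg0]
      exact zero_mem 𝔪
    · exact mem_vanishingIdeal.mp (h rfl) y rfl
  obtain ⟨q, hq⟩ := hmem
  -- Passing to a maximal ideal above `q` yields, by the Nullstellensatz, a point `z`. It lies in
  -- `Z` because `Z` is closed, and it still maps to `y` because the ideal of `y` is contained in
  -- the preimage of `M`.
  obtain ⟨M, hM, hqM⟩ := Ideal.exists_le_maximal q.asIdeal q.isPrime.ne_top
  have hM' : (M.comap (Ideal.Quotient.mk I)).IsMaximal :=
    Ideal.comap_isMaximal_of_surjective _ Ideal.Quotient.mk_surjective
  obtain ⟨z, hz⟩ := eq_vanishingIdeal_singleton_of_isMaximal K hM'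
  refine ⟨z, hc (mem_zeroLocus.mpr fun f hf => ?_), ?_⟩
  · have : f ∈ M.comap (Ideal.Quotient.mk I) := by
      rw [Ideal.mem_comap, Ideal.Quotient.eq_zero_iff_mem.mpr hf]
      exact zero_mem M
    rw [hz] at this
    exact mem_vanishingIdeal.mp this z rfl
  · funext i
    have h1 : X i - C (y i) ∈ 𝔪 := mem_vanishingIdeal.mpr (by rintro _ rfl; simp)
    have h2 : 𝔪 = q.asIdeal.comap φ.toRingHom := congrArg PrimeSpectrum.asIdeal hq.symm
    rw [h2] at h1
    have h3 : bind₁ g (X i - C (y i)) ∈ M.comap (Ideal.Quotient.mk I) := hqM h1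
    rw [hz] at h3
    have := mem_vanishingIdeal.mp h3 z rfl
    simp only [map_sub, bind₁_X_right, bind₁_C_right, eval_C, sub_eq_zero] at this
    exact this

end Param

/-! ### Homogeneous polynomials -/

section Homogeneous

variable {K : Type u} [Field K] {σ : Type}

lemma eval_smul_of_isHomogeneous {f : MvPolynomial σ K} {d : ℕ} (hf : f.IsHomogeneous d) (t : K)
    (x : σ → K) : eval (t • x) f = t ^ d * eval x f := by
  rw [eval_eq, eval_eq, Finset.mul_sum]
  refine Finset.sum_congr rfl fun m hm => ?_
  have hd : ∑ i ∈ m.support, m i = d := by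
    rw [← hf (mem_support_iff.mp hm), ← Finsupp.degree_apply, Finsupp.degree_eq_weight_one]
    rfl
  simp only [Pi.smul_apply, smul_eq_mul, mul_pow, Finset.prod_mul_distrib,
    Finset.prod_pow_eq_pow_sum, hd]
  ring

/-- The restriction of a polynomial to a line through the origin. -/
def restrictLine (f : MvPolynomial σ K) (x : σ → K) : Polynomial K :=
  ∑ d ∈ Finset.range (f.totalDegree + 1),
    Polynomial.C (eval x (homogeneousComponent d f)) * Polynomial.X ^ d

lemma eval_restrictLine (f : MvPolynomial σ K) (x : σ → K) (t : K) :
    (restrictLine f x).eval t = eval (t • x) f := by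
  conv_rhs => rw [← sum_homogeneousComponent f]
  rw [restrictLine, Polynomial.eval_finsetSum, map_sum]
  refine Finset.sum_congr rfl fun d _ => ?_
  rw [eval_smul_of_isHomogeneous (homogeneousComponent_isHomogeneous d f)]
  rw [Polynomial.eval_mul, Polynomial.eval_C, Polynomial.eval_pow, Polynomial.eval_X, mul_comm]

lemma coeff_restrictLine (f : MvPolynomial σ K) (x : σ → K) (d : ℕ) :
    (restrictLine f x).coeff d = eval x (homogeneousComponent d f) := by
  rw [restrictLine, Polynomial.finsetSum_coeff]
  simp only [Polynomial.coeff_C_mul, Polynomial.coeff_X_pow, mul_ite, mul_one, mul_zero]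
  rw [Finset.sum_ite_eq]
  split_ifs with h
  · rfl
  · rw [homogeneousComponent_eq_zero _ _ (by simpa using h), map_zero]

/-- A polynomial in one variable that vanishes outside a given point is zero. -/
lemma polynomial_eq_zero_of_forall_ne [Infinite K] {p : Polynomial K} (c : K)
    (h : ∀ t, t ≠ c → p.eval t = 0) : p = 0 :=
  Polynomial.eq_zero_of_infinite_isRoot p ((Set.finite_singleton c).infinite_compl.mono h)

lemma exists_eval_smul_ne_zero [Infinite K] {f : MvPolynomial σ K} {x : σ → K} {d : ℕ}
    (h : eval x (homogeneousComponent d f) ≠ 0) : ∃ t : K, t ≠ 0 ∧ eval (t • x) f ≠ 0 := by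
  by_contra! hcon
  have : restrictLine f x = 0 := polynomial_eq_zero_of_forall_ne 0 fun t ht => by
    rw [eval_restrictLine]
    exact hcon t ht
  rw [← coeff_restrictLine, this] at h
  exact h rfl

end Homogeneous

/-! ### Affine cones -/

section Cone

variable {K : Type u} [Field K] {N : ℕ}

/-- The affine cone over a subset of projective space. -/
def cone (Z : Set (ProjSpace K N)) : Set (Fin (N + 1) → K) :=
  {x | ∀ h : x ≠ 0, Projectivization.mk K x h ∈ Z}

lemma zero_mem_cone (Z : Set (ProjSpace K N)) : 0 ∈ cone Z := fun h => (h rfl).elim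

lemma mk_smul_eq {x : Fin (N + 1) → K} (hx : x ≠ 0) {t : K} (h : t • x ≠ 0) :
    Projectivization.mk K (t • x) h = Projectivization.mk K x hx := by
  rw [Projectivization.mk_eq_mk_iff']
  exact ⟨t, rfl⟩

lemma smul_mem_cone {Z : Set (ProjSpace K N)} {x : Fin (N + 1) → K} (hx : x ∈ cone Z) (t : K) :
    t • x ∈ cone Z := by
  intro h
  have hx0 : x ≠ 0 := fun h0 => h (by rw [h0, smul_zero])
  rw [mk_smul_eq hx0]
  exact hx hx0

lemma rep_mem_cone {Z : Set (ProjSpace K N)} {P : ProjSpace K N} : P.rep ∈ cone Z ↔ P ∈ Z :=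
  ⟨fun h => by simpa using h P.rep_nonzero, fun h _ => by simpa using h⟩

lemma cone_mono {Y Z : Set (ProjSpace K N)} (h : Y ⊆ Z) : cone Y ⊆ cone Z :=
  fun _ hx h0 => h (hx h0)

lemma eval_rep_mk_eq_zero_iff {f : MvPolynomial (Fin (N + 1)) K} {d : ℕ} (hf : f.IsHomogeneous d)
    {x : Fin (N + 1) → K} (hx : x ≠ 0) :
    eval (Projectivization.mk K x hx).rep f = 0 ↔ eval x f = 0 := by
  obtain ⟨a, ha⟩ := Projectivization.exists_smul_eq_mk_rep K x hx
  rw [← ha, Units.smul_def, eval_smul_of_isHomogeneous hf]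
  simp

lemma isTopologicalBasis_zariski :
    TopologicalSpace.IsTopologicalBasis {U : Set (ProjSpace K N) | ∃ (d : ℕ)
      (f : MvPolynomial (Fin (N + 1)) K), f.IsHomogeneous d ∧
        U = {P | eval P.rep f ≠ 0}} where
  exists_subset_inter := by
    rintro _ ⟨d, f, hf, rfl⟩ _ ⟨e, g, hg, rfl⟩ P ⟨hP, hP'⟩
    refine ⟨_, ⟨d + e, f * g, hf.mul hg, rfl⟩, ?_, ?_⟩
    · simpa using ⟨hP, hP'⟩
    · intro Q hQ
      simpa using hQ
  sUnion_eq := by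
    refine Set.eq_univ_of_forall fun P => ⟨_, ⟨0, 1, isHomogeneous_one _ _, rfl⟩, ?_⟩
    simp
  eq_generateFrom := rfl

lemma mem_closure_iff_homogeneous {Z : Set (ProjSpace K N)} {P : ProjSpace K N} :
    P ∈ closure Z ↔ ∀ (d : ℕ) (f : MvPolynomial (Fin (N + 1)) K), f.IsHomogeneous d →
      (∀ Q ∈ Z, eval Q.rep f = 0) → eval P.rep f = 0 := by
  rw [isTopologicalBasis_zariski.mem_closure_iff]
  constructor
  · intro h d f hf hZ
    by_contra hP
    obtain ⟨Q, hQ, hQZ⟩ := h _ ⟨d, f, hf, rfl⟩ hP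
    exact hQ (hZ Q hQZ)
  · rintro h _ ⟨d, f, hf, rfl⟩ hP
    by_contra hcon
    refine hP (h d f hf fun Q hQ => ?_)
    by_contra hne
    exact hcon ⟨Q, hne, hQ⟩

/-- Non-emptiness matters for constants: the cone over the empty set is `{0}`, where `1` does not
vanish. -/
lemma mem_vanishingIdeal_cone {Z : Set (ProjSpace K N)} (hZ : Z.Nonempty)
    {f : MvPolynomial (Fin (N + 1)) K} {d : ℕ} (hf : f.IsHomogeneous d) :
    f ∈ vanishingIdeal K (cone Z) ↔ ∀ Q ∈ Z, eval Q.rep f = 0 := by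
  rw [mem_vanishingIdeal]
  refine ⟨fun h Q hQ => h _ (rep_mem_cone.mpr hQ), fun h x hx => ?_⟩
  by_cases hx0 : x = 0
  · obtain ⟨Q, hQ⟩ := hZ
    rw [hx0, ← zero_smul K Q.rep, eval_smul_of_isHomogeneous hf, h Q hQ, mul_zero]
  · exact (eval_rep_mk_eq_zero_iff hf hx0).mp (h _ (hx hx0))

lemma homogeneousComponent_mem_vanishingIdeal_cone [Infinite K] {Z : Set (ProjSpace K N)}
    {f : MvPolynomial (Fin (N + 1)) K} (hf : f ∈ vanishingIdeal K (cone Z)) (d : ℕ) :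
    homogeneousComponent d f ∈ vanishingIdeal K (cone Z) := by
  rw [mem_vanishingIdeal] at hf ⊢
  intro x hx
  by_contra hne
  obtain ⟨t, -, ht⟩ := exists_eval_smul_ne_zero hne
  exact ht (hf _ (smul_mem_cone hx t))

lemma mem_vanishingIdeal_cone_of_homogeneousComponent {Z : Set (ProjSpace K N)}
    {f : MvPolynomial (Fin (N + 1)) K}
    (hf : ∀ d, homogeneousComponent d f ∈ vanishingIdeal K (cone Z)) :
    f ∈ vanishingIdeal K (cone Z) := by
  rw [← sum_homogeneousComponent f]
  exact sum_mem fun d _ => hf d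

/-- The ideal of a cone is homogeneous, and projective closures are cut out by homogeneous
polynomials. Hence the dimension of a secant variety can be computed before taking the closure. -/
lemma vanishingIdeal_cone_closure [Infinite K] (Z : Set (ProjSpace K N)) :
    vanishingIdeal K (cone (closure Z)) = vanishingIdeal K (cone Z) := by
  refine le_antisymm (vanishingIdeal_anti_mono (cone_mono subset_closure)) fun f hf => ?_
  rcases Z.eq_empty_or_nonempty with rfl | hZ
  · rwa [closure_empty]
  refine mem_vanishingIdeal_cone_of_homogeneousComponent fun d => ?_
  have hd := homogeneousComponent_mem_vanishingIdeal_cone hf d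
  have hh := homogeneousComponent_isHomogeneous d f
  rw [mem_vanishingIdeal_cone hZ hh] at hd
  rw [mem_vanishingIdeal_cone hZ.closure hh]
  exact fun Q hQ => mem_closure_iff_homogeneous.mp hQ d _ hh hd

lemma affDim_cone_closure [Infinite K] (Z : Set (ProjSpace K N)) :
    affDim (cone (closure Z)) = affDim (cone Z) := by
  rw [affDim, vanishingIdeal_cone_closure, affDim]

lemma zeroLocus_vanishingIdeal_cone_subset {Z : Set (ProjSpace K N)} (hc : IsClosed Z)
    (hZ : Z.Nonempty) : zeroLocus K (vanishingIdeal K (cone Z)) ⊆ cone Z := by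
  intro x hx hx0
  rw [mem_zeroLocus] at hx
  rw [← hc.closure_eq, mem_closure_iff_homogeneous]
  intro d f hf hfZ
  rw [eval_rep_mk_eq_zero_iff hf]
  exact hx f ((mem_vanishingIdeal_cone hZ hf).mpr hfZ)

/-- Primality of a homogeneous ideal need only be tested on homogeneous elements. Their
non-vanishing loci are open in `ℙ^N`, and two of them that meet an irreducible set meet inside it.
-/
lemma isPrime_vanishingIdeal_cone [Infinite K] {Z : Set (ProjSpace K N)} (hZ : IsIrreducible Z) :
    (vanishingIdeal K (cone Z)).IsPrime := by
  let _ := MvPolynomial.gradedAlgebra (σ := Fin (N + 1)) (R := K)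
  refine Ideal.IsHomogeneous.isPrime_of_homogeneous_mem_or_mem
    (𝒜 := homogeneousSubmodule (Fin (N + 1)) K) ?_ ?_ ?_
  · intro d f hf
    have := homogeneousComponent_mem_vanishingIdeal_cone hf d
    rwa [← decomposition.decompose'_apply] at this
  · intro h
    have h1 : (1 : MvPolynomial (Fin (N + 1)) K) ∈ vanishingIdeal K (cone Z) := by
      rw [h]; trivial
    simpa using mem_vanishingIdeal.mp h1 _ (zero_mem_cone Z)
  · rintro f g ⟨d, hf⟩ ⟨e, hg⟩ hfg
    replace hf : f.IsHomogeneous d := hf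
    replace hg : g.IsHomogeneous e := hg
    rw [mem_vanishingIdeal_cone hZ.nonempty (hf.mul hg)] at hfg
    rw [mem_vanishingIdeal_cone hZ.nonempty hf, mem_vanishingIdeal_cone hZ.nonempty hg]
    by_contra! hcon
    obtain ⟨⟨P, hP, hfP⟩, Q, hQ, hgQ⟩ := hcon
    obtain ⟨R, hR, hfR, hgR⟩ := hZ.isPreirreducible _ _
      (isTopologicalBasis_zariski.isOpen ⟨d, f, hf, rfl⟩)
      (isTopologicalBasis_zariski.isOpen ⟨e, g, hg, rfl⟩) ⟨P, hP, hfP⟩ ⟨Q, hQ, hgQ⟩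
    have := hfg R hR
    rw [map_mul] at this
    exact (mul_eq_zero.mp this).elim hfR hgR

lemma affDim_cone_add_one_le [Infinite K] {C D : Set (ProjSpace K N)} (hC : IsIrreducible C)
    (hD : IsIrreducible D) (hCc : IsClosed C) (hCD : C ⊂ D) :
    affDim (cone C) + 1 ≤ affDim (cone D) := by
  have := isPrime_vanishingIdeal_cone hC
  have := isPrime_vanishingIdeal_cone hD
  refine trdeg_quotient_add_one_le (lt_of_le_of_ne
    (vanishingIdeal_anti_mono (cone_mono hCD.subset)) fun h => hCD.not_subset fun P hP => ?_)
  rw [← rep_mem_cone]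
  refine zeroLocus_vanishingIdeal_cone_subset hCc hC.nonempty ?_
  rw [← h]
  exact zeroLocus_vanishingIdeal_le _ (rep_mem_cone.mpr hP)

/-- The prime ideal of the cone lies strictly inside that of the origin. -/
lemma one_le_affDim_cone [Infinite K] {C : Set (ProjSpace K N)} (hC : IsIrreducible C) :
    1 ≤ affDim (cone C) := by
  have := isPrime_vanishingIdeal_cone hC
  have h0 : vanishingIdeal K (cone C) ≤ vanishingIdeal K {(0 : Fin (N + 1) → K)} :=
    vanishingIdeal_anti_mono (by simpa using zero_mem_cone C)
  have hlt : vanishingIdeal K (cone C) < vanishingIdeal K {(0 : Fin (N + 1) → K)} := by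
    refine lt_of_le_of_ne h0 fun h => ?_
    obtain ⟨P, hP⟩ := hC.nonempty
    refine P.rep_nonzero (funext fun i => ?_)
    have hX : (X i : MvPolynomial (Fin (N + 1)) K) ∈ vanishingIdeal K (cone C) := by
      rw [h, mem_vanishingIdeal]
      simp
    simpa using mem_vanishingIdeal.mp hX _ (rep_mem_cone.mpr hP)
  exact le_trans le_add_self (trdeg_quotient_add_one_le hlt)

/-- The dimension of a subset of projective space is less than that of its affine cone. -/
lemma le_affDim_cone_of_le_topologicalKrullDim [Infinite K] {Z : Set (ProjSpace K N)} {n : ℕ}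
    (h : (n : WithBot ℕ∞) ≤ topologicalKrullDim Z) :
    ((n + 1 : ℕ) : Cardinal.{u}) ≤ affDim (cone Z) := by
  obtain ⟨l, hl⟩ := Order.le_krullDim_iff.mp h
  -- Closures in `ℙ^N` keep the chain strict. The cone over its bottom member has dimension at least
  -- `1`, and each step adds at least `1`.
  have hmono := TopologicalSpace.IrreducibleCloseds.map_strictMono_of_isInducing
    (Topology.IsInducing.subtypeVal (t := Z))
  let L := l.map _ hmono
  have key : ∀ (i : ℕ) (hi : i < L.length + 1),
      ((i + 1 : ℕ) : Cardinal.{u}) ≤ affDim (cone (L ⟨i, hi⟩ : Set (ProjSpace K N))) := by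
    intro i
    induction i with
    | zero =>
      intro hi
      simpa using one_le_affDim_cone (L ⟨0, hi⟩).isIrreducible
    | succ i ih =>
      intro hi
      have hlt : L ⟨i, by omega⟩ < L ⟨i + 1, hi⟩ := L.strictMono (by simp)
      refine le_trans ?_ (affDim_cone_add_one_le (L ⟨i, by omega⟩).isIrreducible
        (L ⟨i + 1, hi⟩).isIrreducible (L ⟨i, by omega⟩).isClosed hlt)
      push_cast
      exact add_le_add_left (by exact_mod_cast ih (by omega)) 1
  have hlen : L.length = n := hl
  refine (key n (by omega)).trans ?_
  rw [← affDim_cone_closure Z]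
  refine affDim_mono (cone_mono (closure_mono ?_))
  rintro _ ⟨P, -, rfl⟩
  exact P.2

end Cone

/-! ### Affine charts -/

section Chart

variable {K : Type u} [Field K] {N : ℕ}

/-- The part of the affine cone over `Z` where the `i`-th coordinate is `1`. -/
def chart (i : Fin (N + 1)) (Z : Set (ProjSpace K N)) : Set (Fin (N + 1) → K) :=
  {x | x ∈ cone Z ∧ x i = 1}

lemma ne_zero_of_apply_eq_one {x : Fin (N + 1) → K} {i : Fin (N + 1)} (hx : x i = 1) : x ≠ 0 := by
  rintro rfl
  simp at hx

/-- The homogenization of a polynomial with respect to the `i`-th variable. -/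
def homogenize (i : Fin (N + 1)) (f : MvPolynomial (Fin (N + 1)) K) :
    MvPolynomial (Fin (N + 1)) K :=
  ∑ d ∈ Finset.range (f.totalDegree + 1),
    X i ^ (f.totalDegree - d) * homogeneousComponent d f

lemma isHomogeneous_homogenize (i : Fin (N + 1)) (f : MvPolynomial (Fin (N + 1)) K) :
    (homogenize i f).IsHomogeneous f.totalDegree := by
  refine IsHomogeneous.sum _ _ _ fun d hd => ?_
  have h := (isHomogeneous_X_pow (R := K) i (f.totalDegree - d)).mul
    (homogeneousComponent_isHomogeneous d f)
  rwa [Nat.sub_add_cancel (by simpa [Nat.lt_succ_iff] using hd)] at h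

lemma eval_homogenize {i : Fin (N + 1)} (f : MvPolynomial (Fin (N + 1)) K)
    {x : Fin (N + 1) → K} (hx : x i = 1) : eval x (homogenize i f) = eval x f := by
  conv_rhs => rw [← sum_homogeneousComponent f]
  rw [homogenize, map_sum, map_sum]
  refine Finset.sum_congr rfl fun d _ => ?_
  simp [hx]

/-- The points of `ℙ^N` in the `i`-th chart with affine coordinates in `W`. -/
def chartPoints (i : Fin (N + 1)) (W : Set (Fin (N + 1) → K)) : Set (ProjSpace K N) :=
  {P | ∃ x ∈ W, x i = 1 ∧ ∃ h : x ≠ 0, P = Projectivization.mk K x h}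

lemma chartPoints_mono {i : Fin (N + 1)} {V W : Set (Fin (N + 1) → K)} (h : V ⊆ W) :
    chartPoints i V ⊆ chartPoints i W :=
  fun _ ⟨x, hx, h1⟩ => ⟨x, h hx, h1⟩

lemma isIrreducible_chartPoints {i : Fin (N + 1)} {W : Set (Fin (N + 1) → K)}
    (hW : (vanishingIdeal K W).IsPrime) (hi : ∀ x ∈ W, x i = 1) :
    IsIrreducible (chartPoints i W) := by
  constructor
  · obtain ⟨x, hx⟩ := nonempty_of_isPrime_vanishingIdeal hW
    exact ⟨_, x, hx, hi x hx, ne_zero_of_apply_eq_one (hi x hx), rfl⟩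
  · rintro u v hu hv ⟨_, ⟨x, hx, -, hx0, rfl⟩, hxu⟩ ⟨_, ⟨y, hy, -, hy0, rfl⟩, hyv⟩
    obtain ⟨_, ⟨d, f, hf, rfl⟩, hfx, hfu⟩ :=
      isTopologicalBasis_zariski.exists_subset_of_mem_open hxu hu
    obtain ⟨_, ⟨e, g, hg, rfl⟩, hgy, hgv⟩ :=
      isTopologicalBasis_zariski.exists_subset_of_mem_open hyv hv
    have hf' : f ∉ vanishingIdeal K W := fun h =>
      hfx ((eval_rep_mk_eq_zero_iff hf hx0).mpr (mem_vanishingIdeal.mp h x hx))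
    have hg' : g ∉ vanishingIdeal K W := fun h =>
      hgy ((eval_rep_mk_eq_zero_iff hg hy0).mpr (mem_vanishingIdeal.mp h y hy))
    have hfg : f * g ∉ vanishingIdeal K W := fun h => (hW.mem_or_mem h).elim hf' hg'
    simp only [mem_vanishingIdeal, not_forall, map_mul] at hfg
    obtain ⟨z, hz, hne⟩ := hfg
    have hz0 := ne_zero_of_apply_eq_one (hi z hz)
    refine ⟨_, ⟨z, hz, hi z hz, hz0, rfl⟩, hfu ?_, hgv ?_⟩
    · exact fun h => left_ne_zero_of_mul hne ((eval_rep_mk_eq_zero_iff hf hz0).mp h)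
    · exact fun h => right_ne_zero_of_mul hne ((eval_rep_mk_eq_zero_iff hg hz0).mp h)

/-- Homogenizing turns an equation of `W` into an equation of the projective closure. This makes
passage to closures injective on closed subsets of a chart. -/
lemma vanishingIdeal_le_of_chartPoints_subset_closure {i : Fin (N + 1)}
    {V W : Set (Fin (N + 1) → K)} (hV : ∀ x ∈ V, x i = 1)
    (h : chartPoints i V ⊆ closure (chartPoints i W)) :
    vanishingIdeal K W ≤ vanishingIdeal K V := by
  intro f hf
  rw [mem_vanishingIdeal] at hf ⊢
  intro x hx
  have hx0 := ne_zero_of_apply_eq_one (hV x hx)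
  have hh := isHomogeneous_homogenize i f
  rw [← eval_homogenize f (hV x hx), ← eval_rep_mk_eq_zero_iff hh hx0]
  refine mem_closure_iff_homogeneous.mp (h ⟨x, hx, hV x hx, hx0, rfl⟩) _ _ hh ?_
  rintro _ ⟨y, hy, hy1, hy0, rfl⟩
  rw [eval_rep_mk_eq_zero_iff hh, eval_homogenize f hy1]
  exact hf y hy

variable {Z : Set (ProjSpace K N)} {i : Fin (N + 1)}

/-- By rescaling, `f` vanishes on the chart iff `X i` times its homogenization vanishes on the cone,
and `X i` cancels modulo the prime ideal of the cone. -/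
lemma isPrime_vanishingIdeal_chart (hZ : (vanishingIdeal K (cone Z)).IsPrime)
    (hi : X i ∉ vanishingIdeal K (cone Z)) : (vanishingIdeal K (chart i Z)).IsPrime := by
  have key : ∀ f : MvPolynomial (Fin (N + 1)) K, f ∈ vanishingIdeal K (chart i Z) ↔
      homogenize i f ∈ vanishingIdeal K (cone Z) := by
    intro f
    constructor
    · intro h
      have hmem : X i * homogenize i f ∈ vanishingIdeal K (cone Z) := by
        rw [mem_vanishingIdeal]
        intro x hx
        by_cases hxi : x i = 0
        · simp [hxi]
        · have hc : (x i)⁻¹ • x ∈ chart i Z := ⟨smul_mem_cone hx _, by simp [hxi]⟩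
          have h0 := mem_vanishingIdeal.mp h _ hc
          rw [← eval_homogenize f hc.2, eval_smul_of_isHomogeneous (isHomogeneous_homogenize i f),
            mul_eq_zero] at h0
          have := h0.resolve_left (pow_ne_zero _ (inv_ne_zero hxi))
          rw [map_mul, this, mul_zero]
      exact (hZ.mem_or_mem hmem).resolve_left hi
    · intro h
      rw [mem_vanishingIdeal] at h ⊢
      intro x hx
      rw [← eval_homogenize f hx.2]
      exact h x hx.1
  refine ⟨fun h => ?_, fun {f g} hfg => ?_⟩
  · have h1 : (1 : MvPolynomial (Fin (N + 1)) K) ∈ vanishingIdeal K (chart i Z) := by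
      rw [h]; trivial
    rw [mem_vanishingIdeal] at h1
    refine hi (mem_vanishingIdeal.mpr fun x hx => ?_)
    by_contra hxi
    rw [eval_X] at hxi
    simpa using h1 ((x i)⁻¹ • x) ⟨smul_mem_cone hx _, by simp [hxi]⟩
  · rw [key f, key g]
    refine hZ.mem_or_mem ?_
    have hmem : X i * (homogenize i f * homogenize i g) ∈ vanishingIdeal K (cone Z) := by
      rw [mem_vanishingIdeal]
      intro x hx
      by_cases hxi : x i = 0
      · simp [hxi]
      · have hc : (x i)⁻¹ • x ∈ chart i Z := ⟨smul_mem_cone hx _, by simp [hxi]⟩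
        have h0 := mem_vanishingIdeal.mp hfg _ hc
        rw [map_mul, ← eval_homogenize f hc.2, ← eval_homogenize g hc.2, ← map_mul,
          eval_smul_of_isHomogeneous
            ((isHomogeneous_homogenize i f).mul (isHomogeneous_homogenize i g)),
          mul_eq_zero] at h0
        have := h0.resolve_left (pow_ne_zero _ (inv_ne_zero hxi))
        rw [map_mul, this, mul_zero]
    exact (hZ.mem_or_mem hmem).resolve_left hi

/-- The map `(x, c) ↦ c • x` from chart times line has dense image in the cone. -/
lemma affDim_cone_le_affDim_chart_add_one [Infinite K]
    (hZ : (vanishingIdeal K (cone Z)).IsPrime)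
    (hi : X i ∉ vanishingIdeal K (cone Z)) : affDim (cone Z) ≤ affDim (chart i Z) + 1 := by
  have hp := isPrime_vanishingIdeal_chart hZ hi
  let W : Set (Fin (N + 1) ⊕ Unit → K) := affProd (chart i Z) Set.univ
  let g : Fin (N + 1) → MvPolynomial (Fin (N + 1) ⊕ Unit) K :=
    fun j => X (Sum.inr ()) * X (Sum.inl j)
  have hu : vanishingIdeal K (Set.univ : Set (Unit → K)) = ⊥ := vanishingIdeal_univ
  have h1 : affDim (cone Z) ≤ affDim (polyMap g '' W) := by
    refine trdeg_quotient_le_of_comap_eq (AlgHom.id K _) _ _ ?_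
    ext f
    rw [Ideal.mem_comap, AlgHom.id_apply]
    constructor
    · intro h
      rw [mem_vanishingIdeal] at h ⊢
      rintro _ ⟨x, hx, rfl⟩
      have : polyMap g x = x (Sum.inr ()) • (x ∘ Sum.inl) := by
        funext j
        simp [polyMap, g]
      rw [this]
      exact h _ (smul_mem_cone hx.1.1 _)
    · intro h
      have hmem : X i * f ∈ vanishingIdeal K (cone Z) := by
        rw [mem_vanishingIdeal] at h ⊢
        intro x hx
        by_cases hxi : x i = 0
        · simp [hxi]
        · have hc : (x i)⁻¹ • x ∈ chart i Z := ⟨smul_mem_cone hx _, by simp [hxi]⟩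
          have := h x ⟨Sum.elim ((x i)⁻¹ • x) (fun _ => x i),
            sumElim_mem_affProd hc trivial, by
              funext j
              simp [polyMap, g, hxi]⟩
          rw [map_mul, this, mul_zero]
      exact (hZ.mem_or_mem hmem).resolve_left hi
  refine h1.trans ((affDim_polyMap_image_le g W).trans ?_)
  refine (affDim_affProd_le hp (by rw [hu]; exact Ideal.isPrime_bot)).trans ?_
  rw [affDim_eq_card_of_vanishingIdeal_eq_bot hu]
  simp

/-- The dimension of an irreducible closed subset of projective space is at least that of its affine
cone minus one. -/
lemma le_topologicalKrullDim_of_le_affDim_cone [IsAlgClosed K] (hc : IsClosed Z)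
    (hZ : (vanishingIdeal K (cone Z)).IsPrime) {d : ℕ}
    (hd : ((d + 1 : ℕ) : Cardinal.{u}) ≤ affDim (cone Z)) :
    (d : WithBot ℕ∞) ≤ topologicalKrullDim Z := by
  have : Infinite K := IsAlgClosed.instInfinite
  obtain ⟨i, hi⟩ : ∃ i, (X i : MvPolynomial (Fin (N + 1)) K) ∉ vanishingIdeal K (cone Z) := by
    by_contra! hcon
    have hbot : cone Z ⊆ {0} := fun x hx => by
      funext i
      simpa using mem_vanishingIdeal.mp (hcon i) x hx
    have h1 := hd.trans (affDim_mono hbot)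
    rw [affDim_singleton_zero] at h1
    simp at h1
  have hp := isPrime_vanishingIdeal_chart hZ hi
  let R := MvPolynomial (Fin (N + 1)) K ⧸ vanishingIdeal K (chart i Z)
  have hR : (d : Cardinal.{u}) ≤ Algebra.trdeg K R := by
    have := hd.trans (affDim_cone_le_affDim_chart_add_one hZ hi)
    push_cast at this
    exact (Cardinal.add_one_le_add_one_iff).mp this
  refine (trdeg_le_ringKrullDim hR).trans ?_
  -- A prime of `R` is sent to the projective closure of its zero locus in the chart. Larger primes
  -- have smaller loci, whence the dual order; the Nullstellensatz recovers the prime.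
  rw [ringKrullDim, ← Order.krullDim_orderDual]
  let I : PrimeSpectrum R → Ideal (MvPolynomial (Fin (N + 1)) K) :=
    fun q => q.asIdeal.comap (Ideal.Quotient.mk _)
  have hIle : ∀ q, vanishingIdeal K (chart i Z) ≤ I q := fun q f hf => by
    rw [Ideal.mem_comap, Ideal.Quotient.eq_zero_iff_mem.mpr hf]
    exact zero_mem _
  have hIp : ∀ q, (I q).IsPrime := fun q => Ideal.comap_isPrime _ _
  let W : PrimeSpectrum R → Set (Fin (N + 1) → K) := fun q => zeroLocus K (I q)
  have hWI : ∀ q, vanishingIdeal K (W q) = I q := fun q => IsPrime.vanishingIdeal_zeroLocus _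
  have hX : X i - 1 ∈ vanishingIdeal K (chart i Z) :=
    mem_vanishingIdeal.mpr fun x hx => by simp [hx.2]
  have hW1 : ∀ q, ∀ x ∈ W q, x i = 1 := fun q x hx => by
    have := mem_zeroLocus.mp hx _ (hIle q hX)
    simpa [sub_eq_zero] using this
  have hWZ : ∀ q, chartPoints i (W q) ⊆ Z := by
    rintro q _ ⟨x, hx, hx1, hx0, rfl⟩
    refine zeroLocus_vanishingIdeal_cone_subset hc ?_ (mem_zeroLocus.mpr fun f hf => ?_) hx0
    · obtain ⟨y, hy⟩ := nonempty_of_isPrime_vanishingIdeal hp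
      exact ⟨_, hy.1 (ne_zero_of_apply_eq_one hy.2)⟩
    · exact mem_zeroLocus.mp hx f (hIle q (vanishingIdeal_anti_mono (fun _ h => h.1) hf))
  have hWZ' : ∀ q, closure (chartPoints i (W q)) ⊆ Z := fun q => closure_minimal (hWZ q) hc
  have hirr : ∀ q, IsIrreducible (closure (chartPoints i (W q))) := fun q =>
    (isIrreducible_chartPoints (by rw [hWI]; exact hIp q) (hW1 q)).closure
  let Φ : (PrimeSpectrum R)ᵒᵈ → TopologicalSpace.IrreducibleCloseds Z := fun q =>
    { carrier := Subtype.val ⁻¹' closure (chartPoints i (W (OrderDual.ofDual q)))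
      isIrreducible' := by
        obtain ⟨⟨P, hP⟩, hpre⟩ := hirr (OrderDual.ofDual q)
        refine ⟨⟨⟨P, hWZ' _ hP⟩, hP⟩, ?_⟩
        rintro _ _ ⟨u, hu, rfl⟩ ⟨v, hv, rfl⟩ ⟨x, hx, hxu⟩ ⟨y, hy, hyv⟩
        obtain ⟨z, hz, hzuv⟩ := hpre u v hu hv ⟨x, hx, hxu⟩ ⟨y, hy, hyv⟩
        exact ⟨⟨z, hWZ' _ hz⟩, hz, hzuv⟩
      isClosed' := isClosed_closure.preimage continuous_subtype_val }
  refine Order.krullDim_le_of_strictMono Φ (Monotone.strictMono_of_injective ?_ ?_)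
  · intro q r hqr x hx
    exact closure_mono (chartPoints_mono (zeroLocus_anti_mono (Ideal.comap_mono hqr))) hx
  · have hle : ∀ q r : (PrimeSpectrum R)ᵒᵈ, Φ q ≤ Φ r →
        I (OrderDual.ofDual r) ≤ I (OrderDual.ofDual q) := by
      intro q r h
      rw [← hWI, ← hWI]
      refine vanishingIdeal_le_of_chartPoints_subset_closure (hW1 _) fun P hP => ?_
      exact h (show (⟨P, hWZ _ hP⟩ : Z) ∈ Φ q from subset_closure hP)
    intro q r h
    have hI : I q.ofDual = I r.ofDual := le_antisymm (hle r q h.ge) (hle q r h.le)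
    refine PrimeSpectrum.ext ?_
    exact Ideal.comap_injective_of_surjective _ Ideal.Quotient.mk_surjective hI

end Chart

/-! ### Sums of points of a set -/

section SumSet

variable {K : Type u} [Field K] {σ : Type}

/-- The set of sums of `s` elements of `C`. -/
def sumSet (C : Set (σ → K)) (s : ℕ) : Set (σ → K) :=
  {x | ∃ y : Fin s → σ → K, (∀ i, y i ∈ C) ∧ x = ∑ i, y i}

lemma sumSet_zero (C : Set (σ → K)) : sumSet C 0 = {0} := by
  ext x
  simp [sumSet]

/-- Adding a summand is a polynomial map on a product, so irreducibility and dimension bounds follow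
by induction on `s`. -/
lemma sumSet_succ (C : Set (σ → K)) (s : ℕ) :
    sumSet C (s + 1) =
      polyMap (fun j => X (Sum.inl j) + X (Sum.inr j)) '' affProd (sumSet C s) C := by
  ext x
  constructor
  · rintro ⟨y, hy, rfl⟩
    refine ⟨Sum.elim (∑ i : Fin s, y i.castSucc) (y (Fin.last s)),
      sumElim_mem_affProd ⟨_, fun i => hy _, rfl⟩ (hy _), ?_⟩
    rw [Fin.sum_univ_castSucc]
    funext j
    simp [polyMap]
  · rintro ⟨z, ⟨⟨y, hy, hz⟩, hz'⟩, rfl⟩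
    refine ⟨Fin.snoc (α := fun _ => σ → K) y (z ∘ Sum.inr), fun i => ?_, ?_⟩
    · induction i using Fin.lastCases with
      | last => simpa using hz'
      | cast i => simpa using hy i
    · rw [Fin.sum_univ_castSucc]
      simp only [Fin.snoc_castSucc, Fin.snoc_last, ← hz]
      funext j
      simp [polyMap]

lemma sumSet_mono {C : Set (σ → K)} (h0 : 0 ∈ C) {s t : ℕ} (hst : s ≤ t) :
    sumSet C s ⊆ sumSet C t := by
  induction t, hst using Nat.le_induction with
  | base => exact subset_rfl
  | succ t _ ih =>
    refine ih.trans fun x hx => ?_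
    rw [sumSet_succ]
    exact ⟨Sum.elim x 0, sumElim_mem_affProd hx h0, by funext j; simp [polyMap]⟩

lemma sum_mem_sumSet {C : Set (σ → K)} {ι : Type*} (S : Finset ι) (f : ι → σ → K)
    (hf : ∀ i ∈ S, f i ∈ C) : ∑ i ∈ S, f i ∈ sumSet C S.card := by
  refine ⟨fun i => f (S.equivFin.symm i), fun i => hf _ (S.equivFin.symm i).2, ?_⟩
  rw [← Finset.sum_coe_sort S f]
  exact (Equiv.sum_comp S.equivFin.symm fun i : S => f i).symm

lemma smul_mem_sumSet {C : Set (σ → K)} (hC : ∀ x ∈ C, ∀ t : K, t • x ∈ C) {s : ℕ} {x : σ → K}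
    (hx : x ∈ sumSet C s) (t : K) : t • x ∈ sumSet C s := by
  obtain ⟨y, hy, rfl⟩ := hx
  exact ⟨fun i => t • y i, fun i => hC _ (hy i) t, Finset.smul_sum⟩

lemma isParametrized_singleton_zero [Infinite K] : IsParametrized ({0} : Set (σ → K)) := by
  have h := (isParametrized_univ (K := K) (σ := Empty)).image (fun _ : σ => 0)
  convert h
  ext x
  constructor
  · rintro rfl
    exact ⟨fun _ => 0, trivial, by funext j; simp [polyMap]⟩
  · rintro ⟨y, -, rfl⟩
    funext j
    simp [polyMap]

lemma isParametrized_sumSet [Infinite K] {C : Set (σ → K)} (hC : IsParametrized C) (s : ℕ) :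
    IsParametrized (sumSet C s) := by
  induction s with
  | zero => rw [sumSet_zero]; exact isParametrized_singleton_zero
  | succ s ih => rw [sumSet_succ]; exact (ih.prod hC).image _

lemma affDim_sumSet_add_le [Infinite K] {C : Set (σ → K)} (hC : IsParametrized C) (s t : ℕ) :
    affDim (sumSet C (s + t)) ≤ affDim (sumSet C s) + t * affDim C := by
  induction t with
  | zero => simp
  | succ t ih =>
    rw [← add_assoc, sumSet_succ]
    refine (affDim_polyMap_image_le _ _).trans ((affDim_affProd_le
      (isParametrized_sumSet hC _).isPrime hC.isPrime).trans ?_)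
    refine (add_le_add_left ih _).trans (le_of_eq ?_)
    push_cast
    ring

end SumSet

/-! ### The rank as the length of a sum -/

section Rank

variable {K : Type u} [Field K] {N : ℕ}

lemma mem_span_iff_rep_mem_span (S : Set (ProjSpace K N)) (P : ProjSpace K N) :
    P ∈ Projectivization.Subspace.span S ↔
      P.rep ∈ Submodule.span K (Projectivization.rep '' S) := by
  constructor
  · intro hP
    let M := Submodule.span K (Projectivization.rep '' S)
    have hle : Projectivization.Subspace.span S ≤
        Projectivization.Subspace.submodule.symm M := by
      rw [Projectivization.Subspace.span_le_subspace_iff]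
      intro Q hQ
      have h : Q.rep ∈ Projectivization.Subspace.submodule
          (Projectivization.Subspace.submodule.symm M) := by
        rw [OrderIso.apply_symm_apply]
        exact Submodule.subset_span ⟨Q, hQ, rfl⟩
      rw [Projectivization.Subspace.mem_submodule_iff _ Q.rep_nonzero,
        Projectivization.mk_rep] at h
      exact h
    have h := hle hP
    rw [← Projectivization.mk_rep P,
      ← Projectivization.Subspace.mem_submodule_iff _ P.rep_nonzero,
      OrderIso.apply_symm_apply] at h
    exact h
  · intro hP
    have hle : Submodule.span K (Projectivization.rep '' S) ≤
        Projectivization.Subspace.submodule (Projectivization.Subspace.span S) := by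
      rw [Submodule.span_le]
      rintro _ ⟨Q, hQ, rfl⟩
      rw [SetLike.mem_coe, Projectivization.Subspace.mem_submodule_iff _ Q.rep_nonzero,
        Projectivization.mk_rep]
      exact Projectivization.Subspace.subset_span S hQ
    have h := hle hP
    rwa [Projectivization.Subspace.mem_submodule_iff _ P.rep_nonzero,
        Projectivization.mk_rep] at h

lemma xRank_le_of_mem_sumSet {X : Set (ProjSpace K N)} {P : ProjSpace K N} {s : ℕ}
    (h : P.rep ∈ sumSet (cone X) s) : xRank X P ≤ s := by
  classical
  obtain ⟨y, hy, hP⟩ := h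
  -- Zero summands define no point and proportional ones define the same point; both only lower the
  -- number of distinct points.
  let I : Finset {i : Fin s // y i ≠ 0} := Finset.univ
  let S : Finset (ProjSpace K N) :=
    I.image fun i : {i : Fin s // y i ≠ 0} => Projectivization.mk K (y i.1) i.2
  have hcard : S.card ≤ s := by
    refine Finset.card_image_le.trans ?_
    rw [Finset.card_univ]
    exact (Fintype.card_subtype_le _).trans_eq (Fintype.card_fin s)
  refine (iInf₂_le S ⟨?_, ?_⟩).trans (by exact_mod_cast hcard)
  · intro Q hQ
    simp only [S, Finset.coe_image, Set.mem_image] at hQ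
    obtain ⟨i, -, rfl⟩ := hQ
    exact hy i i.2
  · rw [mem_span_iff_rep_mem_span, hP]
    refine sum_mem fun i _ => ?_
    by_cases hi : y i = 0
    · rw [hi]
      exact zero_mem _
    · obtain ⟨a, ha⟩ := Projectivization.exists_smul_eq_mk_rep K (y i) hi
      have : y i = (a⁻¹ : Kˣ) • (Projectivization.mk K (y i) hi).rep := by
        rw [← ha, inv_smul_smul]
      rw [this]
      refine Submodule.smul_mem _ _ (Submodule.subset_span ⟨_, ?_, rfl⟩)
      simp only [S, Finset.coe_image, Set.mem_image]
      exact ⟨⟨i, hi⟩, Finset.mem_univ _, rfl⟩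

lemma xRank_le_iff {X : Set (ProjSpace K N)} {P : ProjSpace K N} {s : ℕ} :
    xRank X P ≤ s ↔ P.rep ∈ sumSet (cone X) s := by
  refine ⟨fun h => ?_, xRank_le_of_mem_sumSet⟩
  obtain ⟨S, hSX, hPS, hcard⟩ : ∃ S : Finset (ProjSpace K N), (S : Set (ProjSpace K N)) ⊆ X ∧
      P ∈ Projectivization.Subspace.span (S : Set (ProjSpace K N)) ∧ S.card ≤ s := by
    by_contra! hcon
    have : ((s + 1 : ℕ) : ℕ∞) ≤ xRank X P :=
      le_iInf₂ fun S hS => by exact_mod_cast hcon S hS.1 hS.2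
    have := this.trans h
    norm_cast at this
    omega
  rw [mem_span_iff_rep_mem_span, Finsupp.mem_span_image_iff_linearCombination] at hPS
  obtain ⟨l, hl, hlP⟩ := hPS
  rw [Finsupp.mem_supported, Finset.coe_subset] at hl
  rw [← hlP, Finsupp.linearCombination_apply]
  -- Coefficients are absorbed by the cone, and missing summands are padded by `0`.
  refine sumSet_mono (zero_mem_cone X) ((Finset.card_le_card hl).trans hcard)
    (sum_mem_sumSet _ _ fun Q hQ => ?_)
  exact smul_mem_cone (rep_mem_cone.mpr (hSX (hl hQ))) _

lemma cone_setOf_xRank_le (X : Set (ProjSpace K N)) (s : ℕ) :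
    cone {P | xRank X P ≤ s} = sumSet (cone X) s := by
  have hsm : ∀ x ∈ cone X, ∀ t : K, t • x ∈ cone X := fun _ => smul_mem_cone
  ext x
  by_cases hx : x = 0
  · refine iff_of_true (hx ▸ zero_mem_cone _) ⟨0, fun _ => zero_mem_cone _, by simp [hx]⟩
  · obtain ⟨a, ha⟩ := Projectivization.exists_smul_eq_mk_rep K x hx
    have h1 : x ∈ cone {P | xRank X P ≤ s} ↔
        (Projectivization.mk K x hx).rep ∈ sumSet (cone X) s := by
      rw [← xRank_le_iff]
      exact ⟨fun h => h hx, fun h _ => h⟩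
    rw [h1, ← ha]
    refine ⟨fun h => ?_, fun h => smul_mem_sumSet hsm h _⟩
    have := smul_mem_sumSet hsm h (a⁻¹ : Kˣ)
    rwa [← Units.smul_def, inv_smul_smul] at this

end Rank

/-! ### Joins with general linear subspaces -/

section Join

variable {K : Type u} [Field K] {σ : Type} {k : ℕ}

/-- The `(k + 1)`-tuples of vectors whose last member lies in the sum of `W` and the span of the
others. -/
def joinSet (W : Set (σ → K)) (k : ℕ) : Set (Fin (k + 1) × σ → K) :=
  {B | ∃ w ∈ W, ∃ c : Fin k → K,
    ∀ i, B (Fin.last k, i) = w i + ∑ j, c j * B (j.castSucc, i)}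

/-- The set is the image of `W` times the affine space of free vectors and coefficients. -/
lemma isParametrized_joinSet [Infinite K] [Finite σ] {W : Set (σ → K)} (hW : IsParametrized W) :
    IsParametrized (joinSet W k) := by
  let g : Fin (k + 1) × σ → MvPolynomial (σ ⊕ ((Fin k × σ) ⊕ Fin k)) K := fun p =>
    Fin.lastCases (motive := fun _ => MvPolynomial (σ ⊕ ((Fin k × σ) ⊕ Fin k)) K)
      (X (Sum.inl p.2) +
        ∑ j, X (Sum.inr (Sum.inr j)) * X (Sum.inr (Sum.inl (j, p.2))))
      (fun j => X (Sum.inr (Sum.inl (j, p.2)))) p.1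
  have h := (hW.prod (isParametrized_univ (K := K) (σ := (Fin k × σ) ⊕ Fin k))).image g
  convert h
  ext B
  constructor
  · rintro ⟨w, hw, c, hB⟩
    refine ⟨Sum.elim w (Sum.elim (fun p => B (p.1.castSucc, p.2)) c),
      sumElim_mem_affProd hw trivial, ?_⟩
    funext ⟨j, i⟩
    induction j using Fin.lastCases with
    | last => simp [polyMap, g, hB]
    | cast j => simp [polyMap, g]
  · rintro ⟨z, hz, rfl⟩
    refine ⟨z ∘ Sum.inl, hz.1, fun j => z (Sum.inr (Sum.inr j)), fun i => ?_⟩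
    simp [polyMap, g]

/-- If `dim W + k ≥ dim K^σ`, then for general vectors `B_1, …, B_k` the sum of `W` and the span of
`B_1, …, B_k` is dense. The proof specializes the vectors to members of the standard basis. -/
lemma vanishingIdeal_joinSet [Infinite K] [Fintype σ] {W : Set (σ → K)}
    (hW : (vanishingIdeal K W).IsPrime) {r : ℕ} (hcard : Fintype.card σ = k + r)
    (hr : (r : Cardinal.{u}) ≤ affDim W) : vanishingIdeal K (joinSet W k) = ⊥ := by
  classical
  rw [eq_bot_iff]
  intro F hF
  rw [mem_vanishingIdeal] at hF
  by_contra hF0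
  obtain ⟨B₁, hB₁⟩ : ∃ B, eval B F ≠ 0 := by
    by_contra! h
    exact hF0 (MvPolynomial.funext fun x => by simpa using h x)
  obtain ⟨J, hJ, hdom⟩ := exists_coordinates_of_le_affDim hW hr
  have hJc : Fintype.card {i // i ∉ J} = k := by
    rw [Fintype.card_subtype_compl, Fintype.card_coe]
    omega
  let e : Fin k ≃ {i // i ∉ J} := (Fintype.equivFinOfCardEq hJc).symm
  let δ : Fin k → σ → K := fun j => Pi.single (e j).1 1
  let ℓ : Fin k → σ → Polynomial K := fun j i =>
    -- The line from the basis vector `δ j` at `t = 0` to the `j`-th vector of `B₁` at `t = 1`. `H`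
    -- is `F` along these lines, with the last vector left as an indeterminate.
    Polynomial.C (δ j i) + Polynomial.X * Polynomial.C (B₁ (j.castSucc, i) - δ j i)
  let b : Fin (k + 1) × σ → Polynomial (MvPolynomial σ K) := fun p =>
    Fin.lastCases (motive := fun _ => Polynomial (MvPolynomial σ K))
      (Polynomial.C (X p.2)) (fun j => (ℓ j p.2).map C) p.1
  let ev : (σ → K) → K → Polynomial (MvPolynomial σ K) →+* K := fun q t =>
    Polynomial.eval₂RingHom (eval q) t
  let H : Polynomial (MvPolynomial σ K) := aeval b F
  let Bt : (σ → K) → K → Fin (k + 1) × σ → K := fun q t p =>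
    Fin.lastCases (motive := fun _ => K) (q p.2) (fun j => (ℓ j p.2).eval t) p.1
  have hH : ∀ q t, ev q t H = eval (Bt q t) F := by
    intro q t
    have h1 : (ev q t).comp (algebraMap K (Polynomial (MvPolynomial σ K))) = RingHom.id K := by
      ext a
      simp [ev, Polynomial.algebraMap_apply]
    have h2 : (fun p => ev q t (b p)) = Bt q t := by
      funext ⟨j, i⟩
      induction j using Fin.lastCases with
      | last => simp [ev, b, Bt]
      | cast j =>
        have h3 : (eval q).comp (C : K →+* MvPolynomial σ K) = RingHom.id K := by ext; simp
        simp [ev, b, Bt, Polynomial.eval₂_map, h3, Polynomial.eval₂_id]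
    rw [map_aeval, h1, h2]
    rfl
  have hHne : H ≠ 0 := by
    intro h0
    have h1 := hH (fun i => B₁ (Fin.last k, i)) 1
    rw [h0, map_zero] at h1
    refine hB₁ (Eq.trans ?_ h1.symm)
    congr 2
    funext ⟨j, i⟩
    induction j using Fin.lastCases with
    | last => simp [Bt]
    | cast j => simp [Bt, ℓ]
  -- `F` may vanish identically at `t = 0`, so the exact power of `t` is divided out: `H'(0, ·)` is
  -- a non-zero polynomial, which `hdom` will contradict.
  obtain ⟨H', hHH', hH'⟩ := Polynomial.exists_eq_pow_rootMultiplicity_mul_and_not_dvd H hHne 0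
  rw [map_zero, sub_zero] at hHH' hH'
  rw [Polynomial.X_dvd_iff] at hH'
  refine hH' (hdom _ fun w hw x hx => ?_)
  -- The point `Q(t) = w + ∑ c_j ℓ_j(t)` stays in the join, so `H'(t, Q(t)) = 0` for `t ≠ 0` and
  -- hence at `t = 0`. This `c` makes `Q(0) = x`, since the `δ j` fill exactly the coordinates
  -- outside `J`.
  let c : Fin k → K := fun j => x (e j) - w (e j)
  let Q : σ → Polynomial K := fun i => Polynomial.C (w i) + ∑ j, Polynomial.C (c j) * ℓ j i
  let P : Polynomial K := Polynomial.eval₂ (aeval Q : MvPolynomial σ K →ₐ[K] _).toRingHom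
    Polynomial.X H'
  have hP : ∀ t, P.eval t = ev (fun i => (Q i).eval t) t H' := by
    intro t
    rw [← Polynomial.coe_evalRingHom, Polynomial.hom_eval₂]
    have h1 : (Polynomial.evalRingHom t).comp
        (aeval Q : MvPolynomial σ K →ₐ[K] Polynomial K).toRingHom =
        eval fun i => (Q i).eval t := by
      ext <;> simp
    rw [h1]
    simp [ev]
  have hP0 : P = 0 := polynomial_eq_zero_of_forall_ne 0 fun t ht => by
    rw [hP]
    have h1 : ev (fun i => (Q i).eval t) t H = 0 := by
      rw [hH]
      refine hF _ ⟨w, hw, c, fun i => ?_⟩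
      simp [Bt, Q, Polynomial.eval_finsetSum]
    rw [hHH', map_mul, map_pow] at h1
    have h2 : ev (fun i => (Q i).eval t) t Polynomial.X = t := by simp [ev]
    rw [h2] at h1
    exact (mul_eq_zero.mp h1).resolve_left (pow_ne_zero _ ht)
  have h3 := hP 0
  rw [hP0, Polynomial.eval_zero] at h3
  have h4 : (fun i => (Q i).eval 0) = x := by
    funext i
    simp only [Q, ℓ, δ, Polynomial.eval_add, Polynomial.eval_C, Polynomial.eval_finsetSum,
      Polynomial.eval_mul, Polynomial.eval_X, zero_mul, add_zero]
    by_cases hi : i ∈ J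
    · rw [Finset.sum_eq_zero, hx i hi, add_zero]
      intro j _
      rw [Pi.single_eq_of_ne, mul_zero]
      rintro rfl
      exact (e j).2 hi
    · rw [Finset.sum_eq_single (e.symm ⟨i, hi⟩)]
      · simp [c]
      · intro j _ hj
        rw [Pi.single_eq_of_ne, mul_zero]
        rintro rfl
        exact hj (by simp)
      · simp
  rw [h4] at h3
  simpa [ev, Polynomial.eval₂_at_zero] using h3.symm

end Join

/-! ### Linear projections -/

section Projection

variable {K : Type u} [Field K] {n v : ℕ} {V : Grassmannian K v (n + v)}

lemma LinearProjection.map_mem_cone_image (l : LinearProjection V)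
    {Y : Set (ProjSpace K (n + v))} (hVY : V.points ∩ Y = ∅) {y : Fin (n + v + 1) → K}
    (hy : y ∈ cone Y) : l.toLinearMap y ∈ cone (l.image Y) := by
  intro hly
  have hy0 : y ≠ 0 := fun h => hly (by rw [h, map_zero])
  have hmem := hy hy0
  have hnot : Projectivization.mk K y hy0 ∉ V.points := fun h =>
    (Set.ext_iff.mp hVY _).mp ⟨h, hmem⟩
  refine ⟨⟨_, hnot⟩, hmem, ?_⟩
  obtain ⟨a, ha⟩ := Projectivization.exists_smul_eq_mk_rep K y hy0
  rw [LinearProjection.toFun, Projectivization.mk_eq_mk_iff]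
  exact ⟨a, by rw [← ha, Units.smul_def, Units.smul_def, map_smul]⟩

/-- If the centre contains a general tuple of vectors, then every point of the target has bounded
rank with respect to the projected set. -/
lemma xRank_image_le [Infinite K] {Y : Set (ProjSpace K (n + v))} (hVY : V.points ∩ Y = ∅)
    (l : LinearProjection V) {s k : ℕ} {F : MvPolynomial (Fin (k + 1) × Fin (n + v + 1)) K}
    (hF : ∀ B, eval B F ≠ 0 → B ∈ joinSet (sumSet (cone Y) s) k)
    {B : Fin (k + 1) → Fin (n + v + 1) → K} (hB : ∀ j, B j ∈ V.1)
    (hFB : eval (fun p => B p.1 p.2) F ≠ 0) (P : ProjSpace K n) :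
    xRank (l.image Y) P ≤ s := by
  obtain ⟨x, hx⟩ := l.surjective P.rep
  let Bt : K → Fin (k + 1) → Fin (n + v + 1) → K := fun t =>
    Function.update B (Fin.last k) (B (Fin.last k) + t • x)
  have hBt : ∀ t j, Bt t (Fin.castSucc j) = B j.castSucc := fun t j =>
    Function.update_of_ne (Fin.castSucc_ne_last j) _ _
  let p : Polynomial K := aeval (fun q : Fin (k + 1) × Fin (n + v + 1) =>
    Polynomial.C (B q.1 q.2) +
      if q.1 = Fin.last k then Polynomial.X * Polynomial.C (x q.2) else 0) F
  have hp : ∀ t, p.eval t = eval (fun q => Bt t q.1 q.2) F := by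
    intro t
    rw [← Polynomial.coe_evalRingHom, map_aeval]
    have h1 : (Polynomial.evalRingHom t).comp (algebraMap K (Polynomial K)) = RingHom.id K := by
      ext a
      simp
    rw [h1]
    change eval _ F = _
    congr 2
    funext ⟨j, i⟩
    by_cases hj : j = Fin.last k
    · subst hj
      simpa [Bt] using mul_comm _ _
    · simp [Bt, hj]
  -- At `t = 0` the value of `F` is non-zero by `hFB`, so it is non-zero at some other `t` as well.
  obtain ⟨t, ht, hFt⟩ : ∃ t, t ≠ 0 ∧ eval (fun q => Bt t q.1 q.2) F ≠ 0 := by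
    by_contra! hcon
    have hp0 : p = 0 := polynomial_eq_zero_of_forall_ne 0 fun t ht => by rw [hp, hcon t ht]
    have h0 := hp 0
    rw [hp0, Polynomial.eval_zero] at h0
    refine hFB (Eq.trans ?_ h0.symm)
    congr 2
    simp [Bt]
  obtain ⟨w, ⟨y, hy, rfl⟩, c, hc⟩ := hF _ hFt
  have hvec : B (Fin.last k) + t • x = ∑ i, y i + ∑ j, c j • B j.castSucc := by
    funext i
    have := hc i
    simp only [hBt] at this
    simpa [Bt] using this
  have hker : ∀ j, l.toLinearMap (B j) = 0 := fun j => by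
    have := hB j
    rwa [← l.ker_eq] at this
  have hsum : t • P.rep = ∑ i, l.toLinearMap (y i) := by
    have := congrArg l.toLinearMap hvec
    simpa [hker, hx] using this
  refine xRank_le_of_mem_sumSet ⟨fun i => t⁻¹ • l.toLinearMap (y i), fun i =>
    smul_mem_cone (l.map_mem_cone_image hVY (hy i)) _, ?_⟩
  rw [← Finset.smul_sum, ← hsum, inv_smul_smul₀ ht]

end Projection

/-! ### General subspaces -/

section General

variable {K : Type u} [Field K] {r N : ℕ}

/-- Tuples in the span of a frame are its products with square matrices `A`, so the preimage among
frames is a union of principal open sets over all `A`. -/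
lemma isOpen_setOf_exists_eval_ne_zero (F : MvPolynomial (Fin r × Fin (N + 1)) K) :
    IsOpen {V : Grassmannian K r N | ∃ B : Fin r → Fin (N + 1) → K,
      (∀ j, B j ∈ V.1) ∧ eval (fun p => B p.1 p.2) F ≠ 0} := by
  refine isOpen_coinduced.mpr ?_
  let FA : (Fin r → Fin r → K) → MvPolynomial (Fin r × Fin (N + 1)) K := fun A =>
    bind₁ (fun p => ∑ j, C (A p.1 j) * X (j, p.2)) F
  have hFA : ∀ (A : Fin r → Fin r → K) (B : Fin r → Fin (N + 1) → K),
      eval (fun p => B p.1 p.2) (FA A) = eval (fun p => (∑ j, A p.1 j • B j) p.2) F := by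
    intro A B
    rw [← eval_polyMap]
    congr 2
    funext p
    simp [polyMap]
  have heq : Frame.span ⁻¹' {V : Grassmannian K r N | ∃ B : Fin r → Fin (N + 1) → K,
      (∀ j, B j ∈ V.1) ∧ eval (fun p => B p.1 p.2) F ≠ 0} =
      ⋃ A, {B : Frame K r N | eval (fun p => B.1 p.1 p.2) (FA A) ≠ 0} := by
    ext B
    simp only [Set.mem_preimage, Set.mem_ofPred_eq, Set.mem_iUnion, hFA]
    constructor
    · rintro ⟨B', hB', hne⟩
      have hmem : ∀ j, ∃ a : Fin r → K, ∑ i, a i • B.1 i = B' j := fun j =>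
        (Submodule.mem_span_range_iff_exists_fun K).mp (hB' j)
      choose A hA using hmem
      exact ⟨A, by simpa only [hA] using hne⟩
    · rintro ⟨A, hA⟩
      exact ⟨fun j => ∑ i, A j i • B.1 i, fun j =>
        (Submodule.mem_span_range_iff_exists_fun K).mpr ⟨A j, rfl⟩, hA⟩
  rw [heq]
  exact isOpen_iUnion fun A => TopologicalSpace.isOpen_generateFrom_of_mem ⟨FA A, rfl⟩

/-- Multiplying `F` by a maximal minor makes the tuple found linearly independent. -/
lemma nonempty_setOf_exists_eval_ne_zero [Infinite K] (hr : r ≤ N + 1)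
    {F : MvPolynomial (Fin r × Fin (N + 1)) K} (hF : F ≠ 0) :
    {V : Grassmannian K r N | ∃ B : Fin r → Fin (N + 1) → K,
      (∀ j, B j ∈ V.1) ∧ eval (fun p => B p.1 p.2) F ≠ 0}.Nonempty := by
  let D : MvPolynomial (Fin r × Fin (N + 1)) K :=
    Matrix.det (Matrix.of fun i j : Fin r => X (i, Fin.castLE hr j))
  have hD : ∀ B : Fin r → Fin (N + 1) → K, eval (fun p => B p.1 p.2) D =
      Matrix.det (Matrix.of fun i j : Fin r => B i (Fin.castLE hr j)) := by
    intro B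
    rw [RingHom.map_det]
    congr 1
    ext i j
    simp
  have hD0 : D ≠ 0 := by
    intro h
    have h1 := hD fun i => Pi.single (Fin.castLE hr i) 1
    rw [h, map_zero] at h1
    have h2 : (Matrix.of fun i j : Fin r =>
        (Pi.single (Fin.castLE hr i) 1 : Fin (N + 1) → K) (Fin.castLE hr j)) = 1 := by
      ext i j
      simp [Matrix.one_apply, Pi.single_apply, eq_comm]
    rw [h2, Matrix.det_one] at h1
    exact zero_ne_one h1
  obtain ⟨b, hb⟩ : ∃ b, eval b (F * D) ≠ 0 := by
    by_contra! h
    exact mul_ne_zero hF hD0 (MvPolynomial.funext fun x => by simpa using h x)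
  let B : Fin r → Fin (N + 1) → K := fun i j => b (i, j)
  have hbB : b = fun p => B p.1 p.2 := rfl
  rw [map_mul, hbB, hD] at hb
  have hli : LinearIndependent K B := by
    refine LinearIndependent.of_comp (LinearMap.funLeft K K (Fin.castLE hr)) ?_
    exact Matrix.linearIndependent_rows_of_det_ne_zero (right_ne_zero_of_mul hb)
  exact ⟨Frame.span ⟨B, hli⟩, B, fun j => Submodule.subset_span ⟨j, rfl⟩, left_ne_zero_of_mul hb⟩

end General

/-! ### Dimensions of secant varieties -/

section Secant

variable {K : Type u} [Field K] {N : ℕ}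

lemma vanishingIdeal_cone_secantVariety [Infinite K] (Y : Set (ProjSpace K N)) (s : ℕ) :
    vanishingIdeal K (cone (secantVariety Y s)) = vanishingIdeal K (sumSet (cone Y) s) := by
  rw [secantVariety, vanishingIdeal_cone_closure, cone_setOf_xRank_le]

lemma affDim_cone_secantVariety [Infinite K] (Y : Set (ProjSpace K N)) (s : ℕ) :
    affDim (cone (secantVariety Y s)) = affDim (sumSet (cone Y) s) := by
  rw [affDim, vanishingIdeal_cone_secantVariety, affDim]

/-- The infimum defining `genericRank` is attained: by non-degeneracy finitely many points of `Y`
span, and their number bounds every rank. -/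
lemma secantVariety_genericRank {Y : Set (ProjSpace K N)}
    (hY : Projectivization.Subspace.span Y = ⊤) :
    secantVariety Y (genericRank Y) = Set.univ := by
  refine Nat.sInf_mem (s := {s | secantVariety Y s = Set.univ}) ?_
  have htop : Submodule.span K (Projectivization.rep '' Y) = ⊤ := by
    rw [eq_top_iff]
    rintro x -
    by_cases hx : x = 0
    · rw [hx]; exact zero_mem _
    · have h := (mem_span_iff_rep_mem_span Y (Projectivization.mk K x hx)).mp
        (by rw [hY, ← Projectivization.Subspace.span_univ]
            exact Projectivization.Subspace.subset_span _ trivial)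
      obtain ⟨a, ha⟩ := Projectivization.exists_smul_eq_mk_rep K x hx
      rw [← ha, Units.smul_def] at h
      exact (Submodule.smul_mem_iff _ a.ne_zero).mp h
  obtain ⟨t, ht, htspan⟩ : ∃ t : Finset (Fin (N + 1) → K),
      (t : Set _) ⊆ Projectivization.rep '' Y ∧ Submodule.span K (t : Set (Fin (N + 1) → K)) = ⊤ := by
    obtain ⟨b, hb, hspan, hli⟩ := exists_linearIndependent K (Projectivization.rep '' Y)
    have hfin : b.Finite := hli.setFinite
    exact ⟨hfin.toFinset, by simpa using hb, by simpa [htop] using hspan⟩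
  refine ⟨t.card, Set.eq_univ_of_forall fun P => subset_closure (xRank_le_of_mem_sumSet ?_)⟩
  have hP : P.rep ∈ Submodule.span K (id '' (t : Set (Fin (N + 1) → K))) := by
    rw [Set.image_id, htspan]; trivial
  rw [Finsupp.mem_span_image_iff_linearCombination] at hP
  obtain ⟨l, hl, hlP⟩ := hP
  rw [Finsupp.mem_supported, Finset.coe_subset] at hl
  rw [← hlP, Finsupp.linearCombination_apply]
  refine sumSet_mono (zero_mem_cone Y) (Finset.card_le_card hl)
    (sum_mem_sumSet _ _ fun x hx => ?_)
  obtain ⟨Q, hQ, rfl⟩ := ht (hl hx)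
  exact smul_mem_cone (rep_mem_cone.mpr hQ) _

lemma IsNondegenerateVariety.isParametrized_cone [Infinite K] {Y : Set (ProjSpace K N)} {m : ℕ}
    (hY : IsNondegenerateVariety Y m) : IsParametrized (cone Y) :=
  .of_isClosed (zeroLocus_vanishingIdeal_cone_subset hY.isClosed hY.isIrreducible.nonempty)
    (isPrime_vanishingIdeal_cone hY.isIrreducible)

lemma IsNondegenerateVariety.affDim_cone_le [IsAlgClosed K] {Y : Set (ProjSpace K N)} {m : ℕ}
    (hY : IsNondegenerateVariety Y m) : affDim (cone Y) ≤ ((m + 1 : ℕ) : Cardinal.{u}) := by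
  have : Infinite K := IsAlgClosed.instInfinite
  obtain ⟨a, ha⟩ := lt_aleph0.mp (affDim_lt_aleph0 (cone Y))
  by_contra hcon
  rw [ha, Nat.cast_le, not_le] at hcon
  have h := le_topologicalKrullDim_of_le_affDim_cone hY.isClosed
    (isPrime_vanishingIdeal_cone hY.isIrreducible) (d := m + 1) (by rw [ha]; exact_mod_cast hcon)
  rw [hY.dim_eq] at h
  norm_cast at h
  omega

lemma IsNondegenerateVariety.affDim_sumSet_genericRank [Infinite K] {Y : Set (ProjSpace K N)}
    {m : ℕ} (hY : IsNondegenerateVariety Y m) :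
    affDim (sumSet (cone Y) (genericRank Y)) = ((N + 1 : ℕ) : Cardinal.{u}) := by
  have h : vanishingIdeal K (sumSet (cone Y) (genericRank Y)) = ⊥ := by
    rw [← vanishingIdeal_cone_secantVariety, secantVariety_genericRank hY.nondegenerate]
    have : cone (Set.univ : Set (ProjSpace K N)) = Set.univ :=
      Set.eq_univ_of_forall fun _ _ => trivial
    rw [this, vanishingIdeal_univ]
  rw [affDim_eq_card_of_vanishingIdeal_eq_bot h, Fintype.card_fin]

lemma IsNondegenerateVariety.affDim_sumSet_add_le [IsAlgClosed K] {Y : Set (ProjSpace K N)}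
    {m : ℕ} (hY : IsNondegenerateVariety Y m) (s t : ℕ) :
    affDim (sumSet (cone Y) (s + t)) ≤
      affDim (sumSet (cone Y) s) + ((t * (m + 1) : ℕ) : Cardinal.{u}) := by
  have : Infinite K := IsAlgClosed.instInfinite
  refine (XRank.affDim_sumSet_add_le hY.isParametrized_cone s t).trans ?_
  rw [Nat.cast_mul]
  gcongr
  exact hY.affDim_cone_le

lemma IsNondegenerateVariety.le_topologicalKrullDim_secantVariety [IsAlgClosed K]
    {Y : Set (ProjSpace K N)} {m : ℕ} (hY : IsNondegenerateVariety Y m) {s d : ℕ}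
    (h : ((d + 1 : ℕ) : Cardinal.{u}) ≤ affDim (sumSet (cone Y) s)) :
    (d : WithBot ℕ∞) ≤ topologicalKrullDim (secantVariety Y s) := by
  have : Infinite K := IsAlgClosed.instInfinite
  refine le_topologicalKrullDim_of_le_affDim_cone isClosed_closure ?_ ?_
  · change (vanishingIdeal K (cone (secantVariety Y s))).IsPrime
    rw [vanishingIdeal_cone_secantVariety]
    exact (isParametrized_sumSet hY.isParametrized_cone s).isPrime
  · change _ ≤ affDim (cone (secantVariety Y s))
    rwa [affDim_cone_secantVariety]

/-- Passing to `σ_{s-k}` lowers the dimension by at most `k (m + 1)`. -/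
lemma IsNondegenerateVariety.bNumber_add_le [IsAlgClosed K] {n v m : ℕ}
    {Y : Set (ProjSpace K (n + v))} (hY : IsNondegenerateVariety Y m) {k : ℕ}
    (hk : k * (m + 1) < v) : bNumber n v Y + k ≤ genericRank Y ∧
      ((n + 1 : ℕ) : WithBot ℕ∞) ≤ topologicalKrullDim (secantVariety Y (bNumber n v Y)) := by
  have : Infinite K := IsAlgClosed.instInfinite
  have hα := hY.affDim_sumSet_genericRank
  -- Otherwise `n + v + 1 ≤ genericRank Y * (m + 1) ≤ k * (m + 1) < v`.
  have hkα : k ≤ genericRank Y := by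
    have h := hY.affDim_sumSet_add_le 0 (genericRank Y)
    rw [zero_add, sumSet_zero, affDim_singleton_zero, zero_add, hα, Nat.cast_le] at h
    by_contra! hlt
    have := Nat.mul_le_mul_right (m + 1) hlt.le
    omega
  obtain ⟨a, ha⟩ := Nat.exists_eq_add_of_le' hkα
  -- With `a = genericRank Y - k` the cone dimension is at least `n + v + 1 - k (m + 1) ≥ n + 2`, so
  -- the projective dimension is at least `n + 1`.
  have hmem : a ∈ {s | ((n + 1 : ℕ) : WithBot ℕ∞) ≤ topologicalKrullDim (secantVariety Y s)} := by
    refine hY.le_topologicalKrullDim_secantVariety ?_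
    have h := hY.affDim_sumSet_add_le a k
    rw [← ha, hα] at h
    obtain ⟨c, hc⟩ := lt_aleph0.mp (affDim_lt_aleph0 (sumSet (cone Y) a))
    rw [hc] at h ⊢
    norm_cast at h ⊢
    omega
  refine ⟨?_, Nat.sInf_mem ⟨a, hmem⟩⟩
  have : bNumber n v Y ≤ a := Nat.sInf_le hmem
  omega

lemma IsNondegenerateVariety.le_affDim_sumSet_bNumber [IsAlgClosed K] {n v m : ℕ}
    {Y : Set (ProjSpace K (n + v))} (hY : IsNondegenerateVariety Y m) (hv : 1 ≤ v) :
    ((n + 2 : ℕ) : Cardinal.{u}) ≤ affDim (sumSet (cone Y) (bNumber n v Y)) := by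
  have : Infinite K := IsAlgClosed.instInfinite
  rw [← affDim_cone_secantVariety]
  exact le_affDim_cone_of_le_topologicalKrullDim (hY.bNumber_add_le (k := 0) (by omega)).2

lemma IsNondegenerateVariety.exists_forall_mem_joinSet [IsAlgClosed K]
    {Y : Set (ProjSpace K N)} {m : ℕ} (hY : IsNondegenerateVariety Y m) {s k r : ℕ}
    (hcard : N + 1 = k + r) (hr : (r : Cardinal.{u}) ≤ affDim (sumSet (cone Y) s)) :
    ∃ F : MvPolynomial (Fin (k + 1) × Fin (N + 1)) K, F ≠ 0 ∧
      ∀ B, eval B F ≠ 0 → B ∈ joinSet (sumSet (cone Y) s) k := by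
  have : Infinite K := IsAlgClosed.instInfinite
  have hp := isParametrized_sumSet hY.isParametrized_cone s
  exact (isParametrized_joinSet hp).exists_forall_mem
    (vanishingIdeal_joinSet hp.isPrime (by rw [Fintype.card_fin, hcard]) hr)

end Secant

/-! ### The rank with respect to general projections -/

section Main

variable {K : Type u} [Field K] [IsAlgClosed K] {n v m : ℕ} {Y : Set (ProjSpace K (n + v))}

lemma IsNondegenerateVariety.exists_isOpen_forall_xRank_le_genericRank
    (hY : IsNondegenerateVariety Y m) :
    ∃ U : Set (ProjSpace K (n + v)), IsOpen U ∧ U.Nonempty ∧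
      ∀ V : Grassmannian K v (n + v), V.points ∩ Y = ∅ → (V.points ∩ U).Nonempty →
        ∀ (l : LinearProjection V) (P : ProjSpace K n),
          xRank (l.image Y) P ≤ (genericRank Y : ℕ∞) := by
  have hinf : Infinite K := IsAlgClosed.instInfinite
  -- For `k = 0` the join is the sum set itself, regarded as a set of one-vector tuples.
  obtain ⟨F, hF0, hF⟩ := hY.exists_forall_mem_joinSet (k := 0) (r := n + v + 1)
    (zero_add _).symm hY.affDim_sumSet_genericRank.ge
  let f : MvPolynomial (Fin (n + v + 1)) K := rename Prod.snd F
  have hinj : Function.Injective (Prod.snd : Fin (0 + 1) × Fin (n + v + 1) → _) := by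
    rintro ⟨i, j⟩ ⟨i', j'⟩ rfl
    rw [Fin.fin_one_eq_zero i, Fin.fin_one_eq_zero i']
  have hf0 : f ≠ 0 := fun h => hF0 (rename_injective _ hinj (by rw [map_zero]; exact h))
  -- `F` need not be homogeneous, so `U` is defined by one of its non-zero components; for a point
  -- of `U`, `F` is then non-zero at some multiple of its representative.
  obtain ⟨d, hd⟩ : ∃ d, homogeneousComponent d f ≠ 0 := by
    by_contra! h
    exact hf0 (by rw [← sum_homogeneousComponent f]; exact Finset.sum_eq_zero fun d _ => h d)
  have hhom := homogeneousComponent_isHomogeneous d f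
  refine ⟨{P | eval P.rep (homogeneousComponent d f) ≠ 0},
    isTopologicalBasis_zariski.isOpen ⟨d, _, hhom, rfl⟩, ?_, ?_⟩
  -- The factor `X 0` forces `x ≠ 0`, so that `x` defines a point.
  · obtain ⟨x, hx⟩ : ∃ x, eval x (homogeneousComponent d f * X 0) ≠ 0 := by
      by_contra! h
      exact mul_ne_zero hd (X_ne_zero 0) (MvPolynomial.funext fun x => by simpa using h x)
    rw [map_mul, eval_X] at hx
    have hx0 : x ≠ 0 := fun h => right_ne_zero_of_mul hx (by rw [h]; rfl)
    exact ⟨Projectivization.mk K x hx0, fun h => left_ne_zero_of_mul hx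
      ((eval_rep_mk_eq_zero_iff hhom hx0).mp h)⟩
  · rintro V hVY ⟨Q, hQV, hQ⟩ l P
    obtain ⟨t, -, ht⟩ := exists_eval_smul_ne_zero hQ
    have hQmem : Q.rep ∈ V.1 := hQV (by
      rw [Projectivization.submodule_eq]; exact Submodule.mem_span_singleton_self _)
    refine xRank_image_le hVY l hF (B := fun _ => t • Q.rep)
      (fun _ => V.1.smul_mem t hQmem) ?_ P
    rwa [eval_rename] at ht

lemma IsNondegenerateVariety.exists_isOpen_forall_xRank_le_bNumber
    (hY : IsNondegenerateVariety Y m) (hv : 1 ≤ v) :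
    ∃ G : Set (Grassmannian K v (n + v)), IsOpen G ∧ G.Nonempty ∧
      ∀ V ∈ G, V.points ∩ Y = ∅ → ∀ (l : LinearProjection V) (P : ProjSpace K n),
        xRank (l.image Y) P ≤ (bNumber n v Y : ℕ∞) := by
  have hinf : Infinite K := IsAlgClosed.instInfinite
  obtain ⟨k, rfl⟩ : ∃ k, v = k + 1 := ⟨v - 1, by omega⟩
  -- The dimensions just fit: `k + (n + 2) = n + v + 1`.
  obtain ⟨F, hF0, hF⟩ := hY.exists_forall_mem_joinSet (k := k) (r := n + 2) (by omega)
    (hY.le_affDim_sumSet_bNumber hv)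
  refine ⟨_, isOpen_setOf_exists_eval_ne_zero F,
    nonempty_setOf_exists_eval_ne_zero (by omega) hF0, ?_⟩
  rintro V ⟨B, hB, hFB⟩ hVY l P
  exact xRank_image_le hVY l hF hB hFB P

lemma IsNondegenerateVariety.ceil_le_bNumber (hY : IsNondegenerateVariety Y m) (hv : 1 ≤ v) :
    ⌈((n : ℚ) + 1) / ((m : ℚ) + 1)⌉ ≤ (bNumber n v Y : ℤ) := by
  have hinf : Infinite K := IsAlgClosed.instInfinite
  have h := hY.affDim_sumSet_add_le 0 (bNumber n v Y)
  rw [sumSet_zero, affDim_singleton_zero, zero_add, zero_add] at h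
  replace h := (hY.le_affDim_sumSet_bNumber hv).trans h
  rw [Nat.cast_le] at h
  rw [Int.ceil_le, div_le_iff₀ (by positivity)]
  have : ((n + 2 : ℕ) : ℚ) ≤ ((bNumber n v Y * (m + 1) : ℕ) : ℚ) := by exact_mod_cast h
  push_cast at this ⊢
  linarith

lemma IsNondegenerateVariety.bNumber_le (hY : IsNondegenerateVariety Y m) (hv : 1 ≤ v) :
    (bNumber n v Y : ℤ) ≤
      (genericRank Y : ℤ) - ⌈((v : ℚ) - (m : ℚ) - 1) / ((m : ℚ) + 1)⌉ := by
  set z := ⌈((v : ℚ) - (m : ℚ) - 1) / ((m : ℚ) + 1)⌉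
  have hm : (0 : ℚ) < (m : ℚ) + 1 := by positivity
  -- For `v ≥ 1` the fraction exceeds `-1`, so its ceiling is a natural number `k`; rounding up adds
  -- less than `1`, which gives `k (m + 1) < v`.
  have hz0 : 0 ≤ z := by
    rw [← Int.sub_one_lt_iff, Int.lt_ceil, lt_div_iff₀ hm]
    have : (1 : ℚ) ≤ v := by exact_mod_cast hv
    push_cast
    linarith
  obtain ⟨k, hk⟩ := Int.eq_ofNat_of_zero_le hz0
  have hkv : k * (m + 1) < v := by
    have h1 : (z : ℚ) < ((v : ℚ) - m - 1) / (m + 1) + 1 := Int.ceil_lt_add_one _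
    rw [← sub_lt_iff_lt_add, lt_div_iff₀ hm, hk] at h1
    push_cast at h1
    have : ((k * (m + 1) : ℕ) : ℚ) < (v : ℕ) := by
      push_cast
      linarith
    exact_mod_cast this
  have := (hY.bNumber_add_le hkv).1
  omega

end Main

end XRank

end

theorem theorem1 {K : Type*} [Field K] [IsAlgClosed K] [CharZero K] (n v m : ℕ) (hv : 1 ≤ v)
    (Y : Set (XRank.ProjSpace K (n + v))) (hY : XRank.IsNondegenerateVariety Y m) :
    -- (a) `V` contains a general point of `ℙ^(n+v)`
    (∃ U : Set (XRank.ProjSpace K (n + v)), IsOpen U ∧ U.Nonempty ∧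
      ∀ V : XRank.Grassmannian K v (n + v), V.points ∩ Y = ∅ → (V.points ∩ U).Nonempty →
        ∀ (l : XRank.LinearProjection V) (P : XRank.ProjSpace K n),
          XRank.xRank (l.image Y) P ≤ (XRank.genericRank Y : ℕ∞)) ∧
    -- (b) the bounds on `b(Y, v)`, and `V` general
    ⌈((n : ℚ) + 1) / ((m : ℚ) + 1)⌉ ≤ (XRank.bNumber n v Y : ℤ) ∧
    (XRank.bNumber n v Y : ℤ) ≤
      (XRank.genericRank Y : ℤ) - ⌈((v : ℚ) - (m : ℚ) - 1) / ((m : ℚ) + 1)⌉ ∧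
    (∃ G : Set (XRank.Grassmannian K v (n + v)), IsOpen G ∧ G.Nonempty ∧
      ∀ V ∈ G, V.points ∩ Y = ∅ →
        ∀ (l : XRank.LinearProjection V) (P : XRank.ProjSpace K n),
          XRank.xRank (l.image Y) P ≤ (XRank.bNumber n v Y : ℕ∞)) := by
  exact ⟨hY.exists_isOpen_forall_xRank_le_genericRank, hY.ceil_le_bNumber hv, hY.bNumber_le hv,
    hY.exists_isOpen_forall_xRank_le_bNumber hv⟩
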